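/- Let $(V,g)$ be a nonempty compact smooth Riemannian manifold without boundary, of dimension $n\ge 2$, with volume measure $dV_g$ and $\Delta=-\operatorname{div}\nabla$. Let $\varphi,c$ be smooth real functions on $V$, and suppose that $\varphi$ has only finitely many critical points $P_1,\dots,P_N$ and that $c(Q)+\tfrac12\Delta\varphi(Q)\ge 0$ at every minimum point $Q$ of $c$. For $\varepsilon>0$ put $$L_\varepsilon u=\varepsilon\Delta u+\langle\nabla\varphi,\nabla u\rangle+cu,\qquad \psi_\varepsilon=e^{-\varphi/(2\varepsilon)}\ (\text{so } \nabla\varphi=-2\varepsilon\nabla\log\psi_\varepsilon),\qquad a_\varepsilon=c\,\varepsilon+\tfrac14|\nabla\varphi|^2+\tfrac{\varepsilon}{2}\Delta\varphi,$$ and define $\lambda_\varepsilon$ by $$\varepsilon\lambda_\varepsilon=\inf_{v\in H_1(V)\setminus\{0\}}\frac{\varepsilon^2\int_V|\nabla v|^2dV_g+\int_V a_\varepsilon v^2dV_g}{\int_V v^2dV_g},$$ where $H_1(V)$ is the completion of $C^\infty(V)$ in the norm $(\int f^2+\int|\nabla f|^2)^{1/2}$. A weak limit of a family of measures indexed by $\varepsilon$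 is a finite measure which is the weak limit of the family along some sequence of positive $\varepsilon$ tending to $0$. 1. For every $\varepsilon>0$, every smooth $u$ and every real $\lambda$, the function $u$ satisfies $L_\varepsilon u=\lambda u$ if and only if $v=u\psi_\varepsilon$ satisfies $\varepsilon^2\Delta v+a_\varepsilon v=\varepsilon\lambda v$. If $L_\varepsilon u=\lambda u$ with $u$ smooth and $u\not\equiv0$, then $\lambda_\varepsilon\le\lambda$. 2. $\inf_V|\nabla\varphi|^2=0$, and $\varepsilon\lambda_\varepsilon\to\inf_V|\nabla\varphi|^2=0$ as $\varepsilon\to0^+$. 3. For each $\varepsilon>0$ let $v_\varepsilon$ be a minimizer of this variational problem with $\int_V v_\varepsilon^2\,dV_g=1$. The support of every weak limit of the measures $v_\varepsilon^2dV_g$ is contained in the set where $\lim_{\varepsilon\to0^+}a_\varepsilon=0$, and in the set of critical points of $\varphi$. If moreover $v_\varepsilon\ge0$ almost everywhere for every $\varepsilon$, then $\sup_V v_\varepsilon$ (the essential supremum) tends to $+\infty$ as $\varepsilon\to0^+$. 4. For each $\varepsilon>0$ let $u_\varepsilon\not\equiv0$ be a smooth solution of $L_\varepsilon u_\varepsilon=\lambda_\varepsilon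 u_\varepsilon$. Then $u_\varepsilon\psi_\varepsilon$ is a minimizer of the variational problem for every $\varepsilon$, and $$\lim_{\varepsilon\to0^+}\frac{\int_V e^{-\varphi/\varepsilon}u_\varepsilon^2a_\varepsilon\,dV_g}{\int_V e^{-\varphi/\varepsilon}u_\varepsilon^2\,dV_g}=\min_V|\nabla\varphi|^2=0 .$$ Let $m_\varepsilon=e^{-\varphi/\varepsilon}u_\varepsilon^2\,dV_g\big/\int_V e^{-\varphi/\varepsilon}u_\varepsilon^2\,dV_g$. Every sequence $\varepsilon_k\to0^+$ has a subsequence along which $m_\varepsilon$ converges weakly to a measure of the form $\sum_i c_i^2\delta_{P_i}$ with $\sum_i c_i^2=1$. If $m_{\varepsilon_k}$ converges weakly to a finite measure $\mu$ along a sequence $\varepsilon_k\to0^+$, then $\mu=\sum_i c_i^2\delta_{P_i}$ with $\sum_i c_i^2=1$, where, for all sufficiently small $\delta>0$ and all $i$, $c_i^2=\lim_{k}m_{\varepsilon_k}(B_{P_i}(\delta))$, with $B_{P_i}(\delta)$ the open geodesic ball. -/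

import Mathlib

open Set Filter Topology MeasureTheory Manifold Bundle
open scoped ContDiff ENNReal

noncomputable section

namespace RiemGeom

section Geometry

variable (n : ℕ) {M : Type*} [TopologicalSpace M] [ChartedSpace (EuclideanSpace ℝ (Fin n)) M]

/-- Smooth (`C^∞`) real functions on the `n`-dimensional manifold `M`. -/
def Smooth (f : M → ℝ) : Prop :=
  ContMDiff (𝓡 n) 𝓘(ℝ, ℝ) ∞ f

/-- The differential `df_x`, a linear form on the tangent space at `x`. -/
def differential (f : M → ℝ) (x : M) : TangentSpace (𝓡 n) x →L[ℝ] ℝ :=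
  mfderiv (𝓡 n) 𝓘(ℝ, ℝ) f x

/-- The set of critical points of `f` (for smooth `f`: the zeros of the gradient of `f`). -/
def criticalPoints (f : M → ℝ) : Set M :=
  {x | differential n f x = 0}

instance finiteDimensional_tangentSpace (x : M) :
    FiniteDimensional ℝ (TangentSpace (𝓡 n) x) :=
  inferInstanceAs (FiniteDimensional ℝ (EuclideanSpace ℝ (Fin n)))

variable [IsManifold (𝓡 n) ∞ M] [RiemannianBundle (fun x : M => TangentSpace (𝓡 n) x)]

instance completeSpace_tangentSpace (x : M) : CompleteSpace (TangentSpace (𝓡 n) x) :=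
  FiniteDimensional.complete ℝ _

/-- The Riemannian gradient: `⟪grad f x, w⟫ = df_x (w)` for all tangent vectors `w` at `x`. -/
def grad (f : M → ℝ) (x : M) : TangentSpace (𝓡 n) x :=
  (InnerProductSpace.toDual ℝ (TangentSpace (𝓡 n) x)).symm (differential n f x)

/-- The coordinate vector field `∂_i` of the preferred chart at `p`, at the point of `M` with
coordinates `y`. -/
def coordVector (p : M) (y : EuclideanSpace ℝ (Fin n)) (i : Fin n) :
    TangentSpace (𝓡 n) ((extChartAt (𝓡 n) p).symm y) :=
  mfderiv 𝓘(ℝ, EuclideanSpace ℝ (Fin n)) (𝓡 n) (extChartAt (𝓡 n) p).symm y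
    (EuclideanSpace.single i (1 : ℝ) : EuclideanSpace ℝ (Fin n))

/-- The matrix `g_ij = ⟪∂_i, ∂_j⟫` of the metric in the preferred chart at `p`. -/
def metricMatrix (p : M) (y : EuclideanSpace ℝ (Fin n)) : Matrix (Fin n) (Fin n) ℝ :=
  Matrix.of fun i j => inner ℝ (coordVector n p y i) (coordVector n p y j)

/-- The Riemannian volume density `√(det g_ij)` in the preferred chart at `p`. -/
def volDensity (p : M) (y : EuclideanSpace ℝ (Fin n)) : ℝ :=
  Real.sqrt (metricMatrix n p y).det

/-- The components of a vector field in the preferred chart at `p`, as a function of the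
coordinates. -/
def coordField (X : (x : M) → TangentSpace (𝓡 n) x) (p : M) (y : EuclideanSpace ℝ (Fin n)) :
    EuclideanSpace ℝ (Fin n) :=
  mfderiv (𝓡 n) 𝓘(ℝ, EuclideanSpace ℝ (Fin n)) (extChartAt (𝓡 n) p)
    ((extChartAt (𝓡 n) p).symm y) (X ((extChartAt (𝓡 n) p).symm y))

/-- The Riemannian divergence `div X = (1/√g) ∑ i, ∂_i (√g X^i)`, computed at `p` in the preferred
chart at `p`. -/
def divergence (X : (x : M) → TangentSpace (𝓡 n) x) (p : M) : ℝ :=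
  (volDensity n p (extChartAt (𝓡 n) p p))⁻¹ *
    ∑ i : Fin n,
      fderiv ℝ (fun y => volDensity n p y * coordField n X p y i) (extChartAt (𝓡 n) p p)
        (EuclideanSpace.single i (1 : ℝ))

/-- The Laplace-Beltrami operator with the geometers' sign, `Δ f = - div (grad f)`. -/
def laplacian (f : M → ℝ) (p : M) : ℝ :=
  -divergence n (grad n f) p

variable [MeasurableSpace M]

/-- The measure `√g dy` of the preferred chart at `p`, carried over to the domain of that chart. -/
def chartVolume (p : M) : Measure M :=
  (((volume : Measure (EuclideanSpace ℝ (Fin n))).restrict (extChartAt (𝓡 n) p).target).withDensity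
    (fun y => ENNReal.ofReal (volDensity n p y))).map (extChartAt (𝓡 n) p).symm

/-- The Riemannian volume measure `dV_g`. The measures `chartVolume p` agree on the overlaps of the
chart domains; their supremum is the measure on `M` which restricts to `chartVolume p` on the domain
of the chart at `p`, for every `p`. -/
def riemVolume (M : Type*) [TopologicalSpace M] [ChartedSpace (EuclideanSpace ℝ (Fin n)) M]
    [IsManifold (𝓡 n) ∞ M] [RiemannianBundle (fun x : M => TangentSpace (𝓡 n) x)]
    [MeasurableSpace M] : Measure M :=
  ⨆ p : M, chartVolume n p

/-- `v` belongs to the Sobolev space `H_1(M)`, with Dirichlet energy `∫ |∇v|² = E`.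
Here `H_1(M)` is the completion of the smooth functions for the norm
`(∫ f² + ∫ |∇f|²)^(1/2)`, realised inside `L²(M)`: some sequence of smooth functions converges to `v`
in `L²`, its gradients form a Cauchy sequence in `L²`, and their squared `L²` norms tend to `E`. -/
def InH1WithEnergy (v : M → ℝ) (E : ℝ) : Prop :=
  MemLp v 2 (riemVolume n M) ∧
  ∃ f : ℕ → M → ℝ, (∀ k, Smooth n (f k)) ∧
    Tendsto (fun k => ∫ x, (f k x - v x) ^ 2 ∂(riemVolume n M)) atTop (𝓝 0) ∧
    (∀ η > 0, ∃ N, ∀ k ≥ N, ∀ l ≥ N,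
      ∫ x, ‖grad n (f k - f l) x‖ ^ 2 ∂(riemVolume n M) < η) ∧
    Tendsto (fun k => ∫ x, ‖grad n (f k) x‖ ^ 2 ∂(riemVolume n M)) atTop (𝓝 E)

/-- The Rayleigh quotient `(ε² ∫ |∇v|² + ∫ a v²) / ∫ v²` of a function `v` with `∫ |∇v|² = E`. -/
def rayleigh (ε : ℝ) (a v : M → ℝ) (E : ℝ) : ℝ :=
  (ε ^ 2 * E + ∫ x, a x * v x ^ 2 ∂(riemVolume n M)) / ∫ x, v x ^ 2 ∂(riemVolume n M)

/-- The values of the Rayleigh quotient on `H_1(M) \ {0}`. -/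
def rayleighValues (ε : ℝ) (a : M → ℝ) : Set ℝ :=
  {r | ∃ (v : M → ℝ) (E : ℝ), InH1WithEnergy n v E ∧
    ∫ x, v x ^ 2 ∂(riemVolume n M) ≠ 0 ∧ r = rayleigh n ε a v E}

/-- The potential `a_ε = ε c + |∇φ|² / 4 + ε Δφ / 2`. -/
def potential (φ c : M → ℝ) (ε : ℝ) (x : M) : ℝ :=
  c x * ε + ‖grad n φ x‖ ^ 2 / 4 + ε * laplacian n φ x / 2

/-- `λ_ε`, given by `ε λ_ε = inf` of the Rayleigh quotients with potential `a_ε`. -/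
def firstEigenvalue (φ c : M → ℝ) (ε : ℝ) : ℝ :=
  sInf (rayleighValues n ε (potential n φ c ε)) / ε

/-- `v ∈ H_1(M) \ {0}` attains the infimum which defines `ε λ_ε`. -/
def IsMinimizer (φ c : M → ℝ) (ε : ℝ) (v : M → ℝ) : Prop :=
  ∃ E : ℝ, InH1WithEnergy n v E ∧ ∫ x, v x ^ 2 ∂(riemVolume n M) ≠ 0 ∧
    rayleigh n ε (potential n φ c ε) v E = ε * firstEigenvalue n φ c ε

/-- The operator `L_ε u = ε Δu + ∑ b_i ∂_i u + c u`. -/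
def driftOp (ε : ℝ) (b : (x : M) → TangentSpace (𝓡 n) x) (c u : M → ℝ) (x : M) : ℝ :=
  ε * laplacian n u x + differential n u x (b x) + c x * u x

end Geometry

/-- `ψ_ε = exp (-φ / (2ε))`, so that `∇φ = -2ε ∇ (log ψ_ε)`. -/
def gauge {M : Type*} (φ : M → ℝ) (ε : ℝ) (x : M) : ℝ :=
  Real.exp (-φ x / (2 * ε))

/-- The measure `w dV` with density `w ≥ 0`. -/
def densityMeasure {M : Type*} [MeasurableSpace M] (dV : Measure M) (w : M → ℝ) : Measure M :=
  dV.withDensity (fun x => ENNReal.ofReal (w x))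

/-- The normalized measure `e^{-φ/ε} u² dV / ∫ e^{-φ/ε} u² dV`. -/
def normalizedMeasure {M : Type*} [MeasurableSpace M] (dV : Measure M) (φ : M → ℝ) (ε : ℝ)
    (u : M → ℝ) : Measure M :=
  densityMeasure dV (fun x => Real.exp (-φ x / ε) * u x ^ 2 /
    ∫ y, Real.exp (-φ y / ε) * u y ^ 2 ∂dV)

/-- Weak convergence of a sequence of measures on a compact space: convergence of the integrals of
all continuous functions. -/
def WeakConv {M : Type*} [TopologicalSpace M] [MeasurableSpace M] (m : ℕ → Measure M)
    (μ : Measure M) : Prop :=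
  ∀ f : M → ℝ, Continuous f → Tendsto (fun k => ∫ x, f x ∂(m k)) atTop (𝓝 (∫ x, f x ∂μ))

/-- A sequence of positive parameters tending to zero. -/
def IsNullSeq (e : ℕ → ℝ) : Prop :=
  (∀ k, 0 < e k) ∧ Tendsto e atTop (𝓝 0)

/-- The finite measure `μ` is a weak limit, along some sequence of parameters `ε → 0⁺`, of the family
of measures `m ε`. -/
def IsWeakLimit {M : Type*} [TopologicalSpace M] [MeasurableSpace M] (m : ℝ → Measure M)
    (μ : Measure M) : Prop :=
  IsFiniteMeasure μ ∧ ∃ e : ℕ → ℝ, IsNullSeq e ∧ WeakConv (fun k => m (e k)) μ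

/-- The measure `∑ P ∈ S, c_P² δ_P`. -/
def diracSum {M : Type*} [MeasurableSpace M] (S : Finset M) (coef : M → ℝ) : Measure M :=
  ∑ P ∈ S, ENNReal.ofReal (coef P ^ 2) • Measure.dirac P

end RiemGeom

end

set_option linter.unusedSectionVars false
open Set Filter Topology MeasureTheory Manifold Bundle
open scoped ContDiff ENNReal

/-! Conjugation by `gauge φ ε` turns the drift operator into the Schrödinger operator `ε²Δ + a_ε`,
whose potential is `|∇φ|²/4` up to an error `Cε`, with `C` a bound of `|c + Δφ/2|` on the compact
manifold (`laplacian_mul_gauge`, `driftOp_eq_iff`, `exists_potential_bound`). Every Rayleigh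
quotient is therefore at least `-Cε`. A fixed bump function supported where `|∇φ|² < η`, around a
minimum point of `φ`, has quotient at most `η/4 + O(ε)`. Hence `ελ_ε → 0`
(`tendsto_mul_firstEigenvalue`).

The Dirichlet energy of a minimizer is nonnegative, so the normalized integral of `a_ε v²` is at
most `ελ_ε`. With the lower bound on `a_ε` this gives `∫ |∇φ|² v² → 0` for normalized `v`
(`tendsto_integral_norm_grad_sq_minimizer`). All the concentration statements follow from this
single limit and a soft fact: if `S ≥ 0` is continuous on a compact space and probability densities
`ρ` satisfy `∫ Sρ → 0`, then `∫ hρ → 0` for every continuous `h` vanishing on the zeros of `S`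
(`tendsto_integral_mul_zero`). When the zeros are finitely many, the only data that survive are the
masses near each of them, and these lie in a compact cube (`exists_subseq_tendsto_sum`). The blow-up
of the supremum holds because a finite set has zero volume, so a bounded `v` cannot keep unit mass
near it.

Eigenfunctions enter through Green's formula `integral_norm_grad_sq`. The divergence at a point is
defined in the preferred chart of that very point, so its independence of the chart must be known
first. It comes from the weak form: in each chart integration by parts gives `∫ (dχ(X) + χ div X) dV
= 0` for test functions supported there, with one and the same measure `dV`; two continuous
functions with this property on an overlap coincide (`coordDivergence_eq_of_mem`). That the supremum
`riemVolume` really restricts to each chart measure is `riemVolume_restrict_source`. -/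

namespace RiemGeom

/-! ### Derivatives of charts and their inverses. -/

section ChartDerivatives

variable {n : ℕ} {M : Type*} [TopologicalSpace M] [ChartedSpace (EuclideanSpace ℝ (Fin n)) M]

/-- The derivative of the preferred chart at `p`, as an endomorphism of the model space. -/
noncomputable def chartDeriv (p x : M) : EuclideanSpace ℝ (Fin n) →L[ℝ] EuclideanSpace ℝ (Fin n) :=
  mfderiv (𝓡 n) 𝓘(ℝ, EuclideanSpace ℝ (Fin n)) (extChartAt (𝓡 n) p) x

/-- The derivative of the inverse of the preferred chart at `p`, as an endomorphism of the model
space. -/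
noncomputable def symmDeriv (p : M) (y : EuclideanSpace ℝ (Fin n)) :
    EuclideanSpace ℝ (Fin n) →L[ℝ] EuclideanSpace ℝ (Fin n) :=
  mfderiv 𝓘(ℝ, EuclideanSpace ℝ (Fin n)) (𝓡 n) (extChartAt (𝓡 n) p).symm y

variable [IsManifold (𝓡 n) ∞ M]

theorem mdifferentiableAt_extChartAt_symm {p : M} {y : EuclideanSpace ℝ (Fin n)}
    (hy : y ∈ (extChartAt (𝓡 n) p).target) :
    MDifferentiableAt 𝓘(ℝ, EuclideanSpace ℝ (Fin n)) (𝓡 n) (extChartAt (𝓡 n) p).symm y := by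
  have : IsManifold (𝓡 n) 1 M := IsManifold.of_le (n := (∞ : WithTop ℕ∞)) (by simp)
  have := mdifferentiableWithinAt_extChartAt_symm (I := 𝓡 n) hy
  simpa [mdifferentiableWithinAt_univ] using this

theorem chartDeriv_comp_symmDeriv {p : M} {y : EuclideanSpace ℝ (Fin n)}
    (hy : y ∈ (extChartAt (𝓡 n) p).target) :
    (chartDeriv p ((extChartAt (𝓡 n) p).symm y)).comp (symmDeriv p y) =
      ContinuousLinearMap.id ℝ _ := by
  have : IsManifold (𝓡 n) 1 M := IsManifold.of_le (n := (∞ : WithTop ℕ∞)) (by simp)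
  have := mfderiv_extChartAt_comp_mfderivWithin_extChartAt_symm (I := 𝓡 n) hy
  rw [show range (𝓡 n) = univ by simp, mfderivWithin_univ] at this
  exact this

theorem symmDeriv_comp_chartDeriv {p : M} {y : EuclideanSpace ℝ (Fin n)}
    (hy : y ∈ (extChartAt (𝓡 n) p).target) :
    (symmDeriv p y).comp (chartDeriv p ((extChartAt (𝓡 n) p).symm y)) =
      ContinuousLinearMap.id ℝ _ := by
  have : IsManifold (𝓡 n) 1 M := IsManifold.of_le (n := (∞ : WithTop ℕ∞)) (by simp)
  have := mfderivWithin_extChartAt_symm_comp_mfderiv_extChartAt (I := 𝓡 n) hy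
  rw [show range (𝓡 n) = univ by simp, mfderivWithin_univ] at this
  exact this

/-- Near `y` the inverse chart at `p` is the inverse chart at `q` after the transition map; this is
the chain rule for that factorization. It feeds both the transformation of the density and the
change of variables between charts. -/
theorem symmDeriv_eq_comp_fderiv {p q : M} {y : EuclideanSpace ℝ (Fin n)}
    (hy : y ∈ (extChartAt (𝓡 n) p).target)
    (hq : (extChartAt (𝓡 n) p).symm y ∈ (extChartAt (𝓡 n) q).source) :
    DifferentiableAt ℝ (extChartAt (𝓡 n) q ∘ (extChartAt (𝓡 n) p).symm) y ∧
    symmDeriv p y = (symmDeriv q (extChartAt (𝓡 n) q ((extChartAt (𝓡 n) p).symm y))).comp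
      (fderiv ℝ (extChartAt (𝓡 n) q ∘ (extChartAt (𝓡 n) p).symm) y) := by
  have : IsManifold (𝓡 n) 1 M := IsManifold.of_le (n := (∞ : WithTop ℕ∞)) (by simp)
  have h1 := mdifferentiableAt_extChartAt_symm hy
  have h2 : MDifferentiableAt (𝓡 n) 𝓘(ℝ, EuclideanSpace ℝ (Fin n)) (extChartAt (𝓡 n) q)
      ((extChartAt (𝓡 n) p).symm y) :=
    mdifferentiableAt_extChartAt (by simpa using hq)
  have h3 := h2.comp y h1
  refine ⟨h3.differentiableAt, ?_⟩
  have h4 := mdifferentiableAt_extChartAt_symm ((extChartAt (𝓡 n) q).map_source hq)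
  have h5 : (extChartAt (𝓡 n) p).symm =ᶠ[𝓝 y] (extChartAt (𝓡 n) q).symm ∘
      (extChartAt (𝓡 n) q ∘ (extChartAt (𝓡 n) p).symm) := by
    have : (extChartAt (𝓡 n) p).symm ⁻¹' (extChartAt (𝓡 n) q).source ∈ 𝓝 y :=
      h1.continuousAt.preimage_mem_nhds ((isOpen_extChartAt_source q).mem_nhds hq)
    filter_upwards [this] with z hz
    exact ((extChartAt (𝓡 n) q).left_inv hz).symm
  have h6 := h5.mfderiv_eq (I := 𝓘(ℝ, EuclideanSpace ℝ (Fin n))) (I' := 𝓡 n)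
  have h7 := mfderiv_comp y h4 h3
  rw [mfderiv_eq_fderiv] at h7
  exact h6.trans h7

theorem differential_symmDeriv {f : M → ℝ} {p : M} {y : EuclideanSpace ℝ (Fin n)}
    (hy : y ∈ (extChartAt (𝓡 n) p).target)
    (hf : MDifferentiableAt (𝓡 n) 𝓘(ℝ, ℝ) f ((extChartAt (𝓡 n) p).symm y))
    (v : EuclideanSpace ℝ (Fin n)) :
    differential n f ((extChartAt (𝓡 n) p).symm y) (symmDeriv p y v) =
      fderiv ℝ (f ∘ (extChartAt (𝓡 n) p).symm) y v := by
  have h := mfderiv_comp y hf (mdifferentiableAt_extChartAt_symm hy)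
  rw [mfderiv_eq_fderiv] at h
  rw [h]
  rfl

theorem Smooth.contDiffOn {f : M → ℝ} (hf : Smooth n f) (p : M) :
    ContDiffOn ℝ ∞ (f ∘ (extChartAt (𝓡 n) p).symm) (extChartAt (𝓡 n) p).target :=
  (ContMDiff.comp_contMDiffOn hf (contMDiffOn_extChartAt_symm p)).contDiffOn

end ChartDerivatives

/-! ### The metric matrix and the volume density in a chart. -/

section Metric

variable {n : ℕ} {M : Type*} [TopologicalSpace M] [ChartedSpace (EuclideanSpace ℝ (Fin n)) M]
  [IsManifold (𝓡 n) ∞ M] [RiemannianBundle (fun x : M => TangentSpace (𝓡 n) x)]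

/-- The metric at `x` as a function on pairs of vectors of the model space. -/
noncomputable def metricForm (x : M) (v w : EuclideanSpace ℝ (Fin n)) : ℝ :=
  inner ℝ (show TangentSpace (𝓡 n) x from v) (show TangentSpace (𝓡 n) x from w)

theorem differential_eq_inner_grad (f : M → ℝ) (x : M) (w : TangentSpace (𝓡 n) x) :
    inner ℝ (grad n f x) w = differential n f x w := by
  simp [grad]

theorem metricForm_comm (x : M) (v w : EuclideanSpace ℝ (Fin n)) :
    metricForm x v w = metricForm x w v :=
  @real_inner_comm (TangentSpace (𝓡 n) x) _ _ w v

theorem metricMatrix_apply (p : M) (y : EuclideanSpace ℝ (Fin n)) (i j : Fin n) :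
    metricMatrix n p y i j = metricForm ((extChartAt (𝓡 n) p).symm y)
      (symmDeriv p y (EuclideanSpace.single i (1 : ℝ)))
      (symmDeriv p y (EuclideanSpace.single j (1 : ℝ))) := rfl

/-- The Gram matrix of the standard basis of the model space for the metric at `x`. -/
noncomputable def standardGram (n : ℕ) {M : Type*} [TopologicalSpace M]
    [ChartedSpace (EuclideanSpace ℝ (Fin n)) M]
    [RiemannianBundle (fun x : M => TangentSpace (𝓡 n) x)] (x : M) : Matrix (Fin n) (Fin n) ℝ :=
  Matrix.of fun i j => metricForm x (EuclideanSpace.single i (1 : ℝ))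
    (EuclideanSpace.single j (1 : ℝ))

theorem metricForm_sum (x : M) {ι κ : Type*} (s : Finset ι) (t : Finset κ) (a : ι → ℝ) (b : κ → ℝ)
    (v : ι → EuclideanSpace ℝ (Fin n)) (w : κ → EuclideanSpace ℝ (Fin n)) :
    metricForm x (∑ i ∈ s, a i • v i) (∑ j ∈ t, b j • w j) =
      ∑ i ∈ s, ∑ j ∈ t, a i * b j * metricForm x (v i) (w j) := by
  have := @sum_inner ℝ (TangentSpace (𝓡 n) x) _ _ _ ι s (fun i => a i • v i)
    (∑ j ∈ t, b j • w j)
  refine this.trans (Finset.sum_congr rfl fun i _ => ?_)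
  have := @inner_sum ℝ (TangentSpace (𝓡 n) x) _ _ _ κ t (fun j => b j • w j) (a i • v i)
  refine this.trans (Finset.sum_congr rfl fun j _ => ?_)
  have := @real_inner_smul_left (TangentSpace (𝓡 n) x) _ _ (v i) (b j • w j) (a i)
  refine this.trans ?_
  have := @real_inner_smul_right (TangentSpace (𝓡 n) x) _ _ (v i) (w j) (b j)
  rw [mul_assoc]
  exact congrArg (a i * ·) this

theorem sum_single_smul (v : EuclideanSpace ℝ (Fin n)) :
    ∑ i, v i • EuclideanSpace.single i (1 : ℝ) = v := by
  ext j
  simp [Pi.single_apply]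

/-- `G = Aᵀ S A` with `A` the matrix of `symmDeriv p y`. The factor `S` depends on the point of `M`
but not on the chart, so passing to another chart only changes the determinant of `A`. -/
theorem det_metricMatrix (p : M) (y : EuclideanSpace ℝ (Fin n)) :
    (metricMatrix n p y).det = (symmDeriv p y).det ^ 2 *
      (standardGram n ((extChartAt (𝓡 n) p).symm y)).det := by
  set b := (EuclideanSpace.basisFun (Fin n) ℝ).toBasis
  set A := LinearMap.toMatrix b b (symmDeriv p y : EuclideanSpace ℝ (Fin n) →ₗ[ℝ] _)
  have hA : ∀ i k, A k i = symmDeriv p y (EuclideanSpace.single i (1 : ℝ)) k := by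
    intro i k
    simp [A, b, LinearMap.toMatrix_apply]
  have : metricMatrix n p y = A.transpose * standardGram n ((extChartAt (𝓡 n) p).symm y) * A := by
    ext i j
    rw [metricMatrix_apply, ← sum_single_smul (symmDeriv p y (EuclideanSpace.single i (1 : ℝ))),
      ← sum_single_smul (symmDeriv p y (EuclideanSpace.single j (1 : ℝ))), metricForm_sum]
    simp only [Matrix.mul_apply, Matrix.transpose_apply, Finset.sum_mul, hA, standardGram,
      Matrix.of_apply]
    rw [Finset.sum_comm]
    refine Finset.sum_congr rfl fun _ _ => Finset.sum_congr rfl fun _ _ => by ring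
  have hdet : (symmDeriv p y).det = A.det := by
    rw [ContinuousLinearMap.det, ← LinearMap.det_toMatrix b]
  rw [this, Matrix.det_mul, Matrix.det_mul, Matrix.det_transpose, hdet]
  ring

theorem metricForm_self_pos (x : M) {v : EuclideanSpace ℝ (Fin n)} (hv : v ≠ 0) :
    0 < metricForm x v v :=
  (@real_inner_self_pos (TangentSpace (𝓡 n) x) _ _ v).2 hv

/-- The matrix is the Gram matrix of the images of the basis vectors under an injective map, hence
positive definite. -/
theorem det_metricMatrix_pos {p : M} {y : EuclideanSpace ℝ (Fin n)}
    (hy : y ∈ (extChartAt (𝓡 n) p).target) : 0 < (metricMatrix n p y).det := by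
  have hinj : Function.Injective (symmDeriv p y) := by
    refine Function.LeftInverse.injective
      (g := chartDeriv p ((extChartAt (𝓡 n) p).symm y)) fun v => ?_
    exact DFunLike.congr_fun (chartDeriv_comp_symmDeriv hy) v
  refine (Matrix.PosDef.of_dotProduct_mulVec_pos ?_ fun a ha => ?_).det_pos
  · ext i j
    exact metricForm_comm _ _ _
  · set v : EuclideanSpace ℝ (Fin n) := WithLp.toLp 2 a
    have hv : v ≠ 0 := fun h => ha (by simpa [v] using h)
    have h := metricForm_self_pos ((extChartAt (𝓡 n) p).symm y)
      ((map_ne_zero_iff _ hinj).2 hv)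
    rw [← sum_single_smul v, map_sum] at h
    simp only [map_smul] at h
    rw [metricForm_sum] at h
    simp only [dotProduct, Matrix.mulVec, Finset.mul_sum, metricMatrix_apply, Pi.star_apply,
      star_trivial]
    refine h.trans_eq (Finset.sum_congr rfl fun i _ => Finset.sum_congr rfl fun j _ => ?_)
    simp only [v]
    ring

theorem volDensity_pos {p : M} {y : EuclideanSpace ℝ (Fin n)}
    (hy : y ∈ (extChartAt (𝓡 n) p).target) : 0 < volDensity n p y :=
  Real.sqrt_pos.2 (det_metricMatrix_pos hy)

theorem volDensity_eq (p : M) (y : EuclideanSpace ℝ (Fin n)) :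
    volDensity n p y = |(symmDeriv p y).det| *
      Real.sqrt (standardGram n ((extChartAt (𝓡 n) p).symm y)).det := by
  rw [volDensity, det_metricMatrix, Real.sqrt_mul (sq_nonneg _), Real.sqrt_sq_eq_abs]

theorem volDensity_change {p q : M} {y : EuclideanSpace ℝ (Fin n)}
    (hy : y ∈ (extChartAt (𝓡 n) p).target)
    (hq : (extChartAt (𝓡 n) p).symm y ∈ (extChartAt (𝓡 n) q).source) :
    volDensity n p y = |(fderiv ℝ (extChartAt (𝓡 n) q ∘ (extChartAt (𝓡 n) p).symm) y).det| *
      volDensity n q (extChartAt (𝓡 n) q ((extChartAt (𝓡 n) p).symm y)) := by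
  rw [volDensity_eq, volDensity_eq, (symmDeriv_eq_comp_fderiv hy hq).2,
    (extChartAt (𝓡 n) q).left_inv hq]
  have : ∀ A B : EuclideanSpace ℝ (Fin n) →L[ℝ] EuclideanSpace ℝ (Fin n),
      (A.comp B).det = A.det * B.det := fun A B => LinearMap.det_comp _ _
  rw [this, abs_mul]
  ring

variable [IsContMDiffRiemannianBundle (𝓡 n) ∞ (EuclideanSpace ℝ (Fin n))
      (fun x : M => TangentSpace (𝓡 n) x)]

/-- Over the domain of the chart at `p`, the trivialization of the tangent bundle at `p` reads this
section as a constant vector. -/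
theorem contMDiffOn_coordVector (p : M) (i : Fin n) :
    ContMDiffOn (𝓡 n) ((𝓡 n).prod 𝓘(ℝ, EuclideanSpace ℝ (Fin n))) ∞
      (fun x : M => TotalSpace.mk' (EuclideanSpace ℝ (Fin n)) (E := fun x : M => TangentSpace (𝓡 n) x)
        x (symmDeriv p (extChartAt (𝓡 n) p x) (EuclideanSpace.single i (1 : ℝ))))
      (chartAt (EuclideanSpace ℝ (Fin n)) p).source := by
  have : IsManifold (𝓡 n) 1 M := IsManifold.of_le (n := (∞ : WithTop ℕ∞)) (by simp)
  -- The tangent bundle loses one derivative, which costs nothing since `∞ + 1` is `∞`.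
  have : IsManifold (𝓡 n) ((∞ : WithTop ℕ∞) + 1) M := inferInstanceAs (IsManifold (𝓡 n) ∞ M)
  have : ContMDiffVectorBundle ∞ (EuclideanSpace ℝ (Fin n))
    (TangentSpace (𝓡 n) : M → Type _) (𝓡 n) := TangentBundle.contMDiffVectorBundle
  set e := trivializationAt (EuclideanSpace ℝ (Fin n)) (fun x : M => TangentSpace (𝓡 n) x) p
  have hb : e.baseSet = (chartAt (EuclideanSpace ℝ (Fin n)) p).source := rfl
  rw [← hb]
  refine (e.contMDiffOn_section_baseSet_iff (E := (TangentSpace (𝓡 n) : M → Type _)) (IB := 𝓡 n) (n := ∞) (s := fun x =>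
    (symmDeriv p (extChartAt (𝓡 n) p x) (EuclideanSpace.single i (1 : ℝ)) :
      TangentSpace (𝓡 n) x))).2 ?_
  apply (contMDiffOn_const (c := EuclideanSpace.single i (1 : ℝ))).congr
  intro x hx
  have h1 := TangentBundle.symmL_trivializationAt (I := 𝓡 n) (x₀ := p) (x := x) hx
  rw [show range (𝓡 n) = univ by simp, mfderivWithin_univ] at h1
  have h2 : symmDeriv p (extChartAt (𝓡 n) p x) (EuclideanSpace.single i (1 : ℝ)) =
    e.symmL ℝ x (EuclideanSpace.single i (1 : ℝ)) := by rw [h1]; rfl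
  rw [h2, Trivialization.symmL_apply, Trivialization.apply_mk_symm _ hx]
  exact hx

theorem contDiffOn_metricMatrix (p : M) (i j : Fin n) :
    ContDiffOn ℝ ∞ (fun y => metricMatrix n p y i j) (extChartAt (𝓡 n) p).target := by
  have h := (contMDiffOn_coordVector p i).inner_bundle (contMDiffOn_coordVector p j)
  have h2 := h.comp (contMDiffOn_extChartAt_symm (I := 𝓡 n) p) (fun y hy => by
    simpa using (extChartAt (𝓡 n) p).map_target hy)
  refine h2.contDiffOn.congr fun y hy => ?_
  rw [metricMatrix_apply, Function.comp_apply, (extChartAt (𝓡 n) p).right_inv hy]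
  rfl

end Metric

/-! ### Inverse metric and gradient in coordinates. -/

theorem contDiffOn_det {ι E : Type*} [Fintype ι] [DecidableEq ι] [NormedAddCommGroup E]
    [NormedSpace ℝ E] {s : Set E} {k : WithTop ℕ∞} {A : E → Matrix ι ι ℝ}
    (hA : ∀ i j, ContDiffOn ℝ k (fun y => A y i j) s) : ContDiffOn ℝ k (fun y => (A y).det) s := by
  simp only [Matrix.det_apply]
  refine ContDiffOn.sum fun σ _ => ?_
  simp only [Units.smul_def, zsmul_eq_mul]
  exact contDiffOn_const.mul (contDiffOn_prod fun i _ => hA _ _)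

/-- Cramer's rule: each entry of the adjugate is the determinant of the matrix with one row replaced
by a constant one. -/
theorem contDiffOn_matrix_inv {ι E : Type*} [Fintype ι] [DecidableEq ι] [NormedAddCommGroup E]
    [NormedSpace ℝ E] {s : Set E} {k : WithTop ℕ∞} {A : E → Matrix ι ι ℝ}
    (hA : ∀ i j, ContDiffOn ℝ k (fun y => A y i j) s) (hdet : ∀ y ∈ s, (A y).det ≠ 0) (i j : ι) :
    ContDiffOn ℝ k (fun y => (A y)⁻¹ i j) s := by
  simp only [Matrix.inv_def, Matrix.smul_apply, Ring.inverse_eq_inv', smul_eq_mul,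
    Matrix.adjugate_apply]
  refine ((contDiffOn_det hA).inv hdet).mul (contDiffOn_det fun a b => ?_)
  by_cases h : a = j
  · subst h
    simpa using contDiffOn_const
  · simpa [Matrix.updateRow_ne h] using hA a b

section Coordinates

variable {n : ℕ} {M : Type*} [TopologicalSpace M] [ChartedSpace (EuclideanSpace ℝ (Fin n)) M]
  [IsManifold (𝓡 n) ∞ M] [RiemannianBundle (fun x : M => TangentSpace (𝓡 n) x)]

theorem symmDeriv_coordField (X : (x : M) → TangentSpace (𝓡 n) x) {p : M}
    {y : EuclideanSpace ℝ (Fin n)} (hy : y ∈ (extChartAt (𝓡 n) p).target) :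
    symmDeriv p y (coordField n X p y) = X ((extChartAt (𝓡 n) p).symm y) :=
  DFunLike.congr_fun (symmDeriv_comp_chartDeriv hy) (X ((extChartAt (𝓡 n) p).symm y))

theorem differential_apply_field {f : M → ℝ} (X : (x : M) → TangentSpace (𝓡 n) x) {p : M}
    {y : EuclideanSpace ℝ (Fin n)} (hy : y ∈ (extChartAt (𝓡 n) p).target)
    (hf : MDifferentiableAt (𝓡 n) 𝓘(ℝ, ℝ) f ((extChartAt (𝓡 n) p).symm y)) :
    differential n f ((extChartAt (𝓡 n) p).symm y) (X ((extChartAt (𝓡 n) p).symm y)) =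
      fderiv ℝ (f ∘ (extChartAt (𝓡 n) p).symm) y (coordField n X p y) := by
  rw [← differential_symmDeriv hy hf, symmDeriv_coordField X hy]

/-- Pairing the gradient with each coordinate vector gives the linear system `G X = df`; it is
solved by inverting `G`. The formula makes gradients of smooth functions smooth in coordinates. -/
theorem coordField_grad {f : M → ℝ} {p : M} {y : EuclideanSpace ℝ (Fin n)}
    (hy : y ∈ (extChartAt (𝓡 n) p).target)
    (hf : MDifferentiableAt (𝓡 n) 𝓘(ℝ, ℝ) f ((extChartAt (𝓡 n) p).symm y)) (i : Fin n) :
    coordField n (grad n f) p y i = ∑ j, (metricMatrix n p y)⁻¹ i j *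
      fderiv ℝ (f ∘ (extChartAt (𝓡 n) p).symm) y (EuclideanSpace.single j (1 : ℝ)) := by
  set x := (extChartAt (𝓡 n) p).symm y with hx
  set G := metricMatrix n p y with hG
  have key : ∀ j, ∑ k, G j k * coordField n (grad n f) p y k =
      fderiv ℝ (f ∘ (extChartAt (𝓡 n) p).symm) y (EuclideanSpace.single j (1 : ℝ)) := by
    intro j
    rw [← differential_symmDeriv hy hf]
    refine Eq.trans ?_ (differential_eq_inner_grad f x _)
    -- The single vector `∂_j` is written as a one-term sum so that `metricForm_sum` expands both
    -- slots at once.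
    have h1 : metricForm x (grad n f x) (symmDeriv p y (EuclideanSpace.single j (1 : ℝ))) =
        metricForm x (∑ a ∈ ({j} : Finset (Fin n)), (1 : ℝ) •
          symmDeriv p y (EuclideanSpace.single a (1 : ℝ)))
          (∑ k, coordField n (grad n f) p y k • symmDeriv p y (EuclideanSpace.single k (1 : ℝ))) := by
      have h2 : ∑ k, coordField n (grad n f) p y k • symmDeriv p y (EuclideanSpace.single k (1 : ℝ))
          = grad n f x := by
        rw [← symmDeriv_coordField (grad n f) hy]
        conv_rhs => rw [← sum_single_smul (coordField n (grad n f) p y)]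
        rw [map_sum]
        simp only [map_smul]
      rw [h2, Finset.sum_singleton, one_smul]
      exact metricForm_comm _ _ _
    refine Eq.trans ?_ h1.symm
    rw [metricForm_sum, Finset.sum_singleton]
    refine Finset.sum_congr rfl fun k _ => ?_
    rw [hG, metricMatrix_apply]
    ring
  have hdet : IsUnit G.det := (det_metricMatrix_pos hy).ne'.isUnit
  have h3 : G.mulVec (fun k => coordField n (grad n f) p y k) =
      fun j => fderiv ℝ (f ∘ (extChartAt (𝓡 n) p).symm) y (EuclideanSpace.single j (1 : ℝ)) :=
    funext key
  have h4 := congrArg (G⁻¹.mulVec) h3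
  rw [Matrix.mulVec_mulVec, Matrix.nonsing_inv_mul _ hdet, Matrix.one_mulVec] at h4
  exact congrFun h4 i

variable [IsContMDiffRiemannianBundle (𝓡 n) ∞ (EuclideanSpace ℝ (Fin n))
      (fun x : M => TangentSpace (𝓡 n) x)]

theorem contDiffOn_volDensity (p : M) :
    ContDiffOn ℝ ∞ (volDensity n p) (extChartAt (𝓡 n) p).target :=
  (contDiffOn_det (contDiffOn_metricMatrix p)).sqrt fun _ hy => (det_metricMatrix_pos hy).ne'

theorem contDiffOn_coordField_grad {f : M → ℝ} (hf : Smooth n f) (p : M) (i : Fin n) :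
    ContDiffOn ℝ ∞ (fun y => coordField n (grad n f) p y i) (extChartAt (𝓡 n) p).target := by
  have h : ∀ j, ContDiffOn ℝ ∞ (fun y => fderiv ℝ (f ∘ (extChartAt (𝓡 n) p).symm) y
      (EuclideanSpace.single j (1 : ℝ))) (extChartAt (𝓡 n) p).target := fun j =>
    ((hf.contDiffOn p).fderiv_of_isOpen (isOpen_extChartAt_target p) (by simp)).clm_apply
      contDiffOn_const
  refine ContDiffOn.congr (ContDiffOn.sum fun j _ => (contDiffOn_matrix_inv
    (contDiffOn_metricMatrix p) (fun y hy => (det_metricMatrix_pos hy).ne') i j).mul (h j))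
    fun y hy => coordField_grad hy (ContMDiff.mdifferentiable hf (by simp) _) i

end Coordinates

end RiemGeom

namespace RiemGeom

/-! ### Algebra of the divergence. -/

section Divergence

variable {n : ℕ} {M : Type*} [TopologicalSpace M] [ChartedSpace (EuclideanSpace ℝ (Fin n)) M]

/-- A vector field whose components in the preferred charts are smooth. -/
def SmoothField (X : (x : M) → TangentSpace (𝓡 n) x) : Prop :=
  ∀ (p : M) (i : Fin n),
    ContDiffOn ℝ ∞ (fun y => coordField n X p y i) (extChartAt (𝓡 n) p).target

theorem coordField_smul (f : M → ℝ) (X : (x : M) → TangentSpace (𝓡 n) x) (p : M)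
    (y : EuclideanSpace ℝ (Fin n)) (i : Fin n) :
    coordField n (fun x => f x • X x) p y i =
      f ((extChartAt (𝓡 n) p).symm y) * coordField n X p y i := by
  have : coordField n (fun x => f x • X x) p y =
      f ((extChartAt (𝓡 n) p).symm y) • coordField n X p y :=
    map_smul (chartDeriv p ((extChartAt (𝓡 n) p).symm y)) _ (X ((extChartAt (𝓡 n) p).symm y))
  rw [this]
  rfl

theorem coordField_add (X Y : (x : M) → TangentSpace (𝓡 n) x) (p : M)
    (y : EuclideanSpace ℝ (Fin n)) (i : Fin n) :
    coordField n (fun x => X x + Y x) p y i = coordField n X p y i + coordField n Y p y i := by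
  have : coordField n (fun x => X x + Y x) p y = coordField n X p y + coordField n Y p y :=
    map_add (chartDeriv p ((extChartAt (𝓡 n) p).symm y)) (X ((extChartAt (𝓡 n) p).symm y))
      (Y ((extChartAt (𝓡 n) p).symm y))
  rw [this]
  rfl

variable [IsManifold (𝓡 n) ∞ M]

theorem SmoothField.smul {f : M → ℝ} (hf : Smooth n f) {X : (x : M) → TangentSpace (𝓡 n) x}
    (hX : SmoothField X) : SmoothField (fun x => f x • X x) := fun p i =>
  ((hf.contDiffOn p).mul (hX p i)).congr fun y _ => coordField_smul f X p y i

theorem Smooth.mdifferentiableAt {f : M → ℝ} (hf : Smooth n f) (x : M) :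
    MDifferentiableAt (𝓡 n) 𝓘(ℝ, ℝ) f x :=
  ContMDiff.mdifferentiable hf (by simp) x

theorem Smooth.differentiableAt_coord {f : M → ℝ} (hf : Smooth n f) {p : M}
    {y : EuclideanSpace ℝ (Fin n)} (hy : y ∈ (extChartAt (𝓡 n) p).target) :
    DifferentiableAt ℝ (f ∘ (extChartAt (𝓡 n) p).symm) y :=
  ((hf.contDiffOn p).differentiableOn (by simp)).differentiableAt
    ((isOpen_extChartAt_target p).mem_nhds hy)

variable [RiemannianBundle (fun x : M => TangentSpace (𝓡 n) x)]

/-- The divergence `(1/√g) ∑ i, ∂_i (√g X^i)` in the preferred chart at `p`, as a function of the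
coordinates. -/
noncomputable def coordDivergence (X : (x : M) → TangentSpace (𝓡 n) x) (p : M)
    (y : EuclideanSpace ℝ (Fin n)) : ℝ :=
  (volDensity n p y)⁻¹ * ∑ i : Fin n,
    fderiv ℝ (fun y => volDensity n p y * coordField n X p y i) y
      (EuclideanSpace.single i (1 : ℝ))

variable [IsContMDiffRiemannianBundle (𝓡 n) ∞ (EuclideanSpace ℝ (Fin n))
      (fun x : M => TangentSpace (𝓡 n) x)]

theorem contDiffOn_density_mul {X : (x : M) → TangentSpace (𝓡 n) x} (hX : SmoothField X) (p : M)
    (i : Fin n) : ContDiffOn ℝ ∞ (fun y => volDensity n p y * coordField n X p y i)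
      (extChartAt (𝓡 n) p).target :=
  (contDiffOn_volDensity p).mul (hX p i)

theorem differentiableAt_density_mul {X : (x : M) → TangentSpace (𝓡 n) x} (hX : SmoothField X)
    {p : M} {y : EuclideanSpace ℝ (Fin n)} (hy : y ∈ (extChartAt (𝓡 n) p).target) (i : Fin n) :
    DifferentiableAt ℝ (fun y => volDensity n p y * coordField n X p y i) y :=
  ((contDiffOn_density_mul hX p i).differentiableOn (by simp)).differentiableAt
    ((isOpen_extChartAt_target p).mem_nhds hy)

theorem continuousOn_coordDivergence {X : (x : M) → TangentSpace (𝓡 n) x} (hX : SmoothField X)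
    (p : M) : ContinuousOn (coordDivergence X p) (extChartAt (𝓡 n) p).target := by
  refine ((contDiffOn_volDensity p).continuousOn.inv₀ fun y hy => (volDensity_pos hy).ne').mul
    (continuousOn_finsetSum _ fun i _ => ?_)
  exact ((contDiffOn_density_mul hX p i).continuousOn_fderiv_of_isOpen
    (isOpen_extChartAt_target p) (by simp)).clm_apply continuousOn_const

theorem coordDivergence_add {X Y : (x : M) → TangentSpace (𝓡 n) x} (hX : SmoothField X)
    (hY : SmoothField Y) {p : M} {y : EuclideanSpace ℝ (Fin n)}
    (hy : y ∈ (extChartAt (𝓡 n) p).target) :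
    coordDivergence (fun x => X x + Y x) p y = coordDivergence X p y + coordDivergence Y p y := by
  simp only [coordDivergence, ← mul_add, ← Finset.sum_add_distrib]
  congr 1
  refine Finset.sum_congr rfl fun i _ => ?_
  have : (fun y => volDensity n p y * coordField n (fun x => X x + Y x) p y i) = fun y =>
      volDensity n p y * coordField n X p y i + volDensity n p y * coordField n Y p y i := by
    funext z
    rw [coordField_add, mul_add]
  rw [this, fderiv_fun_add (differentiableAt_density_mul hX hy i)
    (differentiableAt_density_mul hY hy i)]
  rfl

theorem differential_field_eq_sum {f : M → ℝ} (hf : Smooth n f)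
    (X : (x : M) → TangentSpace (𝓡 n) x) {p : M}
    {y : EuclideanSpace ℝ (Fin n)} (hy : y ∈ (extChartAt (𝓡 n) p).target) :
    differential n f ((extChartAt (𝓡 n) p).symm y) (X ((extChartAt (𝓡 n) p).symm y)) =
      ∑ i, coordField n X p y i * fderiv ℝ (f ∘ (extChartAt (𝓡 n) p).symm) y
        (EuclideanSpace.single i (1 : ℝ)) := by
  rw [differential_apply_field X hy (hf.mdifferentiableAt _)]
  conv_lhs => rw [← sum_single_smul (coordField n X p y)]
  rw [map_sum]
  simp

theorem coordDivergence_smul {f : M → ℝ} (hf : Smooth n f)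
    {X : (x : M) → TangentSpace (𝓡 n) x} (hX : SmoothField X) {p : M}
    {y : EuclideanSpace ℝ (Fin n)} (hy : y ∈ (extChartAt (𝓡 n) p).target) :
    coordDivergence (fun x => f x • X x) p y =
      f ((extChartAt (𝓡 n) p).symm y) * coordDivergence X p y +
        differential n f ((extChartAt (𝓡 n) p).symm y) (X ((extChartAt (𝓡 n) p).symm y)) := by
  rw [differential_field_eq_sum hf X hy]
  simp only [coordDivergence]
  have h : ∀ i, fderiv ℝ (fun y => volDensity n p y * coordField n (fun x => f x • X x) p y i) y
      (EuclideanSpace.single i (1 : ℝ)) = f ((extChartAt (𝓡 n) p).symm y) *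
        fderiv ℝ (fun y => volDensity n p y * coordField n X p y i) y
          (EuclideanSpace.single i (1 : ℝ)) + volDensity n p y * (coordField n X p y i *
        fderiv ℝ (f ∘ (extChartAt (𝓡 n) p).symm) y (EuclideanSpace.single i (1 : ℝ))) := by
    intro i
    have : (fun y => volDensity n p y * coordField n (fun x => f x • X x) p y i) = fun y =>
        (f ∘ (extChartAt (𝓡 n) p).symm) y * (volDensity n p y * coordField n X p y i) := by
      funext z
      rw [coordField_smul, Function.comp_apply]
      ring
    rw [this, fderiv_fun_mul (hf.differentiableAt_coord hy) (differentiableAt_density_mul hX hy i)]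
    simp only [add_apply, smul_apply, smul_eq_mul,
      Function.comp_apply]
    ring
  simp only [h, Finset.sum_add_distrib, ← Finset.mul_sum, mul_add]
  rw [inv_mul_cancel_left₀ (volDensity_pos hy).ne']
  ring

/-- Both sides live in the preferred chart at `p`, so the coordinate identity at the centre of that
chart suffices and no chart independence is involved. The same holds for `divergence_smul`. -/
theorem divergence_add {X Y : (x : M) → TangentSpace (𝓡 n) x} (hX : SmoothField X)
    (hY : SmoothField Y) (p : M) :
    divergence n (fun x => X x + Y x) p = divergence n X p + divergence n Y p :=
  coordDivergence_add hX hY (mem_extChartAt_target p)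

theorem divergence_smul {f : M → ℝ} (hf : Smooth n f) {X : (x : M) → TangentSpace (𝓡 n) x}
    (hX : SmoothField X) (p : M) :
    divergence n (fun x => f x • X x) p = f p * divergence n X p + differential n f p (X p) := by
  have := coordDivergence_smul hf hX (mem_extChartAt_target (I := 𝓡 n) p)
  rwa [extChartAt_to_inv] at this

end Divergence

/-! ### Gradients, and conjugation of the drift operator by the gauge. -/

section Gradient

variable {n : ℕ} {M : Type*} [TopologicalSpace M] [ChartedSpace (EuclideanSpace ℝ (Fin n)) M]

theorem Smooth.continuous {f : M → ℝ} (hf : Smooth n f) : Continuous f := ContMDiff.continuous hf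

theorem Smooth.mul {f g : M → ℝ} (hf : Smooth n f) (hg : Smooth n g) :
    Smooth n (fun x => f x * g x) := ContMDiff.mul hf hg

theorem Smooth.gauge {φ : M → ℝ} (hφ : Smooth n φ) (ε : ℝ) : Smooth n (gauge φ ε) := by
  have h : ContDiff ℝ ∞ (fun t : ℝ => Real.exp (-t / (2 * ε))) := by fun_prop
  exact h.contMDiff.comp hφ

variable [IsManifold (𝓡 n) ∞ M]

theorem differential_mul {f g : M → ℝ} (hf : Smooth n f) (hg : Smooth n g) (x : M) :
    differential n (fun y => f y * g y) x = f x • differential n g x + g x • differential n f x := by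
  have hf' := ((hf.mdifferentiableAt x).hasMFDerivAt)
  have hg' := ((hg.mdifferentiableAt x).hasMFDerivAt)
  exact (hf'.mul hg').mfderiv

theorem differential_gauge {φ : M → ℝ} (hφ : Smooth n φ) (ε : ℝ) (x : M) :
    differential n (gauge φ ε) x = (-(gauge φ ε x) / (2 * ε)) • differential n φ x := by
  have hφ' := ((hφ.mdifferentiableAt x).hasMFDerivAt)
  have h1 : HasDerivAt (fun t : ℝ => Real.exp (-t / (2 * ε)))
      (Real.exp (-φ x / (2 * ε)) * (-1 / (2 * ε))) (φ x) :=
    ((hasDerivAt_id (φ x)).neg.div_const (2 * ε)).exp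
  have h2 := (h1.hasFDerivAt.hasMFDerivAt.comp x hφ').mfderiv
  refine Eq.trans h2 ?_
  ext v
  have h3 : ∀ t e : ℝ, t * (e * (-1 / (2 * ε))) = -e / (2 * ε) * t := fun t e => by ring
  exact h3 (differential n φ x v) (gauge φ ε x)

variable [RiemannianBundle (fun x : M => TangentSpace (𝓡 n) x)]

theorem grad_mul {f g : M → ℝ} (hf : Smooth n f) (hg : Smooth n g) (x : M) :
    grad n (fun y => f y * g y) x = f x • grad n g x + g x • grad n f x := by
  refine ext_inner_right ℝ fun w => ?_
  rw [inner_add_left, real_inner_smul_left, real_inner_smul_left]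
  simp only [differential_eq_inner_grad]
  rw [differential_mul hf hg]
  rfl

theorem grad_gauge {φ : M → ℝ} (hφ : Smooth n φ) (ε : ℝ) (x : M) :
    grad n (gauge φ ε) x = (-(gauge φ ε x) / (2 * ε)) • grad n φ x := by
  refine ext_inner_right ℝ fun w => ?_
  rw [real_inner_smul_left]
  simp only [differential_eq_inner_grad]
  rw [differential_gauge hφ]
  rfl

theorem differential_grad_comm (f g : M → ℝ) (x : M) :
    differential n f x (grad n g x) = differential n g x (grad n f x) := by
  rw [← differential_eq_inner_grad, ← differential_eq_inner_grad, real_inner_comm]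

theorem differential_grad_self (f : M → ℝ) (x : M) :
    differential n f x (grad n f x) = ‖grad n f x‖ ^ 2 := by
  rw [← differential_eq_inner_grad, real_inner_self_eq_norm_sq]

theorem grad_eq_zero_iff (f : M → ℝ) (x : M) : grad n f x = 0 ↔ x ∈ criticalPoints n f := by
  simp [grad, criticalPoints]

variable [IsContMDiffRiemannianBundle (𝓡 n) ∞ (EuclideanSpace ℝ (Fin n))
      (fun x : M => TangentSpace (𝓡 n) x)]

theorem Smooth.smoothField_grad {f : M → ℝ} (hf : Smooth n f) : SmoothField (grad n f) :=
  fun p i => contDiffOn_coordField_grad hf p i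

/-- Here `∇(uψ) = ψ∇u - (uψ/2ε)∇φ`. Taking divergences, each summand contributes half of the cross
term `⟨∇u, ∇φ⟩`, while differentiating `ψ` in the second one produces `|∇φ|²/4`. -/
theorem laplacian_mul_gauge {φ u : M → ℝ} (hφ : Smooth n φ) (hu : Smooth n u) {ε : ℝ} (hε : ε ≠ 0)
    (x : M) :
    ε ^ 2 * laplacian n (fun y => u y * gauge φ ε y) x =
      gauge φ ε x * (ε ^ 2 * laplacian n u x + ε * differential n u x (grad n φ x)
        - u x * (ε / 2 * laplacian n φ x + ‖grad n φ x‖ ^ 2 / 4)) := by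
  have hψ := hφ.gauge ε
  have huψ := hu.mul hψ
  have hk : Smooth n (fun x => -(1 / (2 * ε)) * (u x * gauge φ ε x)) :=
    Smooth.mul (contMDiff_const : Smooth n (fun _ => -(1 / (2 * ε)))) huψ
  have hgrad : grad n (fun y => u y * gauge φ ε y) = fun x =>
      gauge φ ε x • grad n u x + (-(1 / (2 * ε)) * (u x * gauge φ ε x)) • grad n φ x := by
    funext z
    rw [grad_mul hu hψ, grad_gauge hφ, smul_smul, add_comm]
    congr 2
    ring
  have hd : differential n (fun x => -(1 / (2 * ε)) * (u x * gauge φ ε x)) x (grad n φ x) =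
      -(1 / (2 * ε)) * (u x * (-(gauge φ ε x) / (2 * ε) * ‖grad n φ x‖ ^ 2) +
        gauge φ ε x * differential n u x (grad n φ x)) := by
    rw [differential_mul (contMDiff_const : Smooth n (fun _ => -(1 / (2 * ε)))) huψ,
      differential_mul hu hψ, differential_gauge hφ, ← differential_grad_self]
    have h0 : differential n (fun _ : M => -(1 / (2 * ε))) x = 0 := mfderiv_const
    rw [h0, smul_zero, add_zero]
    rfl
  have hd' : differential n (gauge φ ε) x (grad n u x) =
      -(gauge φ ε x) / (2 * ε) * differential n u x (grad n φ x) := by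
    rw [differential_gauge hφ, differential_grad_comm u φ]
    rfl
  rw [laplacian, hgrad, divergence_add (hu.smoothField_grad.smul hψ)
    (hφ.smoothField_grad.smul hk), divergence_smul hψ hu.smoothField_grad,
    divergence_smul hk hφ.smoothField_grad, hd, hd']
  simp only [laplacian]
  field_simp
  ring

/-- The two equations differ, at each point, by the nonzero factor `εψ`. -/
theorem driftOp_eq_iff {φ c u : M → ℝ} (hφ : Smooth n φ) (hu : Smooth n u) {ε : ℝ} (hε : 0 < ε)
    (lam : ℝ) (x : M) :
    driftOp n ε (grad n φ) c u x = lam * u x ↔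
      ε ^ 2 * laplacian n (fun y => u y * gauge φ ε y) x
          + potential n φ c ε x * (u x * gauge φ ε x) = ε * lam * (u x * gauge φ ε x) := by
  have h : ε ^ 2 * laplacian n (fun y => u y * gauge φ ε y) x
      + potential n φ c ε x * (u x * gauge φ ε x) - ε * lam * (u x * gauge φ ε x) =
      (ε * gauge φ ε x) * (driftOp n ε (grad n φ) c u x - lam * u x) := by
    rw [laplacian_mul_gauge hφ hu hε.ne', driftOp, potential]
    ring
  have h0 : ε * gauge φ ε x ≠ 0 := (mul_pos hε (Real.exp_pos _)).ne'
  rw [← sub_eq_zero, ← sub_eq_zero (b := ε * lam * (u x * gauge φ ε x)), h]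
  simp [h0]

end Gradient

end RiemGeom

namespace RiemGeom

/-! ### The Riemannian volume measure. -/

section Volume

variable {n : ℕ} {M : Type*} [TopologicalSpace M] [ChartedSpace (EuclideanSpace ℝ (Fin n)) M]
  [IsManifold (𝓡 n) ∞ M] [RiemannianBundle (fun x : M => TangentSpace (𝓡 n) x)]
  [IsContMDiffRiemannianBundle (𝓡 n) ∞ (EuclideanSpace ℝ (Fin n))
      (fun x : M => TangentSpace (𝓡 n) x)]
  [MeasurableSpace M] [BorelSpace M]

theorem measurableSet_extChartAt_target (p : M) :
    MeasurableSet (extChartAt (𝓡 n) p).target :=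
  (isOpen_extChartAt_target p).measurableSet

theorem aemeasurable_extChartAt_symm (p : M) :
    AEMeasurable (extChartAt (𝓡 n) p).symm
      ((volume : Measure (EuclideanSpace ℝ (Fin n))).restrict (extChartAt (𝓡 n) p).target) :=
  (continuousOn_extChartAt_symm p).aemeasurable (measurableSet_extChartAt_target p)

theorem aemeasurable_extChartAt_symm_withDensity (p : M) :
    AEMeasurable (extChartAt (𝓡 n) p).symm
      (((volume : Measure (EuclideanSpace ℝ (Fin n))).restrict
        (extChartAt (𝓡 n) p).target).withDensity
        (fun y => ENNReal.ofReal (volDensity n p y))) :=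
  (aemeasurable_extChartAt_symm p).mono_ac (withDensity_absolutelyContinuous _ _)

theorem measurableSet_target_inter_preimage (p : M) {S : Set M} (hS : MeasurableSet S) :
    MeasurableSet ((extChartAt (𝓡 n) p).target ∩ (extChartAt (𝓡 n) p).symm ⁻¹' S) := by
  have h := (continuousOn_extChartAt_symm (I := 𝓡 n) p).domRestrict.measurable hS
  have h2 := (measurableSet_extChartAt_target (n := n) p).subtype_image h
  convert h2 using 1
  ext y
  simp [and_comm]

theorem chartVolume_apply (p : M) {S : Set M} (hS : MeasurableSet S) :
    chartVolume n p S = ∫⁻ y in (extChartAt (𝓡 n) p).target ∩ (extChartAt (𝓡 n) p).symm ⁻¹' S,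
      ENNReal.ofReal (volDensity n p y) := by
  rw [chartVolume, Measure.map_apply_of_aemeasurable (aemeasurable_extChartAt_symm_withDensity p) hS]
  have hm := measurableSet_target_inter_preimage (n := n) p hS
  have hae : ((extChartAt (𝓡 n) p).symm ⁻¹' S : Set (EuclideanSpace ℝ (Fin n)))
      =ᵐ[(volume : Measure (EuclideanSpace ℝ (Fin n))).restrict (extChartAt (𝓡 n) p).target]
      ((extChartAt (𝓡 n) p).target ∩ (extChartAt (𝓡 n) p).symm ⁻¹' S : Set _) := by
    filter_upwards [ae_restrict_mem (measurableSet_extChartAt_target p)] with y hy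
    exact propext ⟨fun h => ⟨hy, h⟩, fun h => h.2⟩
  rw [measure_congr ((withDensity_absolutelyContinuous _ _).ae_eq hae),
    withDensity_apply _ hm, Measure.restrict_restrict hm,
    inter_right_comm, inter_self]

theorem chartVolume_compl_source (p : M) : chartVolume n p (extChartAt (𝓡 n) p).sourceᶜ = 0 := by
  rw [chartVolume_apply p (isOpen_extChartAt_source p).measurableSet.compl]
  have : (extChartAt (𝓡 n) p).target ∩ (extChartAt (𝓡 n) p).symm ⁻¹' (extChartAt (𝓡 n) p).sourceᶜ
      = ∅ := by
    ext y
    simp only [mem_inter_iff, mem_preimage, mem_compl_iff, mem_empty_iff_false, iff_false, not_and,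
      not_not]
    exact fun hy => (extChartAt (𝓡 n) p).map_target hy
  rw [this, setLIntegral_empty]

/-- Change of variables along the transition map; its Jacobian is exactly the factor in
`volDensity_change`. -/
theorem chartVolume_eq_of_subset (p q : M) {S : Set M} (hS : MeasurableSet S)
    (hp : S ⊆ (extChartAt (𝓡 n) p).source) (hq : S ⊆ (extChartAt (𝓡 n) q).source) :
    chartVolume n p S = chartVolume n q S := by
  rw [chartVolume_apply p hS, chartVolume_apply q hS]
  set A := (extChartAt (𝓡 n) p).target ∩ (extChartAt (𝓡 n) p).symm ⁻¹' S with hA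
  set τ := extChartAt (𝓡 n) q ∘ (extChartAt (𝓡 n) p).symm
  have hAm : MeasurableSet A := measurableSet_target_inter_preimage p hS
  have himg : (extChartAt (𝓡 n) q).target ∩ (extChartAt (𝓡 n) q).symm ⁻¹' S = τ '' A := by
    ext z
    constructor
    · rintro ⟨hz, hzS⟩
      refine ⟨extChartAt (𝓡 n) p ((extChartAt (𝓡 n) q).symm z),
        ⟨(extChartAt (𝓡 n) p).map_source (hp hzS), ?_⟩, ?_⟩
      · rwa [mem_preimage, (extChartAt (𝓡 n) p).left_inv (hp hzS)]
      · simp only [τ, Function.comp_apply]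
        rw [(extChartAt (𝓡 n) p).left_inv (hp hzS), (extChartAt (𝓡 n) q).right_inv hz]
    · rintro ⟨y, ⟨hy, hyS⟩, rfl⟩
      refine ⟨(extChartAt (𝓡 n) q).map_source (hq hyS), ?_⟩
      simp only [τ, Function.comp_apply, mem_preimage]
      rwa [(extChartAt (𝓡 n) q).left_inv (hq hyS)]
  have hinj : InjOn τ A := by
    rintro y ⟨hy, hyS⟩ z ⟨hz, hzS⟩ hyz
    exact (extChartAt (𝓡 n) p).symm.injOn hy hz
      ((extChartAt (𝓡 n) q).injOn (hq hyS) (hq hzS) hyz)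
  rw [himg, lintegral_image_eq_lintegral_abs_det_fderiv_mul volume hAm
    (fun y hy => (symmDeriv_eq_comp_fderiv hy.1 (hq hy.2)).1.hasFDerivAt.hasFDerivWithinAt) hinj]
  refine setLIntegral_congr_fun hAm fun y hy => ?_
  rw [volDensity_change hy.1 (hq hy.2), ENNReal.ofReal_mul (abs_nonneg _)]
  rfl

variable [CompactSpace M]

variable (n M) in
theorem exists_finset_iUnion_source :
    ∃ t : Finset M, ⋃ p ∈ t, (extChartAt (𝓡 n) p).source = (univ : Set M) := by
  obtain ⟨t, ht⟩ := isCompact_univ.elim_finite_subcover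
    (fun p : M => (extChartAt (𝓡 n) p).source) (fun p => isOpen_extChartAt_source p)
    (fun x _ => mem_iUnion.2 ⟨x, mem_extChartAt_source x⟩)
  exact ⟨t, univ_subset_iff.1 ht⟩

/-- A finite cover by chart domains is made disjoint, and the chart measures are glued along the
pieces to a measure `ν`. Every chart measure lies below `ν`, hence so does their supremum, and on
the domain of the chart at `p` the measure `ν` is `chartVolume n p`. The reverse inequality is
immediate from the supremum. -/
theorem riemVolume_restrict_source (p : M) :
    (riemVolume n M).restrict (extChartAt (𝓡 n) p).source = chartVolume n p := by
  have hle : ∀ q, chartVolume n q ≤ riemVolume n M := fun q => le_iSup (chartVolume n) q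
  refine le_antisymm ?_ ?_
  · obtain ⟨t, ht⟩ := exists_finset_iUnion_source n M
    let U : Fin t.card → Set M := fun j => (extChartAt (𝓡 n) (t.equivFin.symm j : M)).source
    let D : Fin t.card → Set M := disjointed U
    have hU : ∀ j, MeasurableSet (U j) := fun j => (isOpen_extChartAt_source _).measurableSet
    have hD : ∀ j, MeasurableSet (D j) := fun j => by
      exact disjointedRec (fun _ _ h => h.diff (hU _)) (hU j)
    have hDU : ∀ j, D j ⊆ U j := fun j => disjointed_subset U j
    have hdis : Pairwise (Function.onFun Disjoint D) := disjoint_disjointed U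
    have hcov : ⋃ j, D j = univ := by
      rw [iUnion_disjointed, eq_univ_iff_forall]
      intro x
      have hx : x ∈ ⋃ p ∈ t, (extChartAt (𝓡 n) p).source := ht ▸ mem_univ x
      simp only [mem_iUnion] at hx
      obtain ⟨q, hq, hxq⟩ := hx
      exact mem_iUnion.2 ⟨t.equivFin ⟨q, hq⟩, by simpa [U] using hxq⟩
    let ν : Measure M := Measure.sum fun j =>
      (chartVolume n (t.equivFin.symm j : M)).restrict (D j)
    -- On each disjoint piece the measure of the chart at `q` may be replaced by that of the chart
    -- attached to the piece.
    have hchart : ∀ q : M, ∀ S, MeasurableSet S → chartVolume n q S =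
        ∑' j, chartVolume n (t.equivFin.symm j : M)
          (S ∩ (extChartAt (𝓡 n) q).source ∩ D j) := by
      intro q S hS
      have hSq := hS.inter (isOpen_extChartAt_source (I := 𝓡 n) q).measurableSet
      have h1 : chartVolume n q S = chartVolume n q (S ∩ (extChartAt (𝓡 n) q).source) :=
        (measure_inter_conull (chartVolume_compl_source q)).symm
      have h2 : S ∩ (extChartAt (𝓡 n) q).source =
          ⋃ j, S ∩ (extChartAt (𝓡 n) q).source ∩ D j := by
        rw [← inter_iUnion, hcov, inter_univ]
      rw [h1]
      conv_lhs => rw [h2]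
      rw [measure_iUnion (fun i j hij => (hdis hij).mono inter_subset_right inter_subset_right)
        (fun j => hSq.inter (hD j))]
      exact tsum_congr fun j => chartVolume_eq_of_subset _ _ (hSq.inter (hD j))
        (inter_subset_left.trans inter_subset_right) (inter_subset_right.trans (hDU j))
    have hν : ∀ S, MeasurableSet S → ν S = ∑' j, chartVolume n (t.equivFin.symm j : M) (S ∩ D j) :=
      fun S hS => by
        rw [Measure.sum_apply _ hS]
        exact tsum_congr fun j => Measure.restrict_apply hS
    have hRν : riemVolume n M ≤ ν := iSup_le fun q => Measure.le_iff.2 fun S hS => by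
      rw [hchart q S hS, hν S hS]
      exact ENNReal.tsum_le_tsum fun j => measure_mono
        (inter_subset_inter_left _ inter_subset_left)
    refine (Measure.restrict_mono_measure hRν _).trans (Measure.le_iff.2 fun S hS => ?_)
    rw [Measure.restrict_apply hS, hν _ (hS.inter (isOpen_extChartAt_source _).measurableSet),
      hchart p S hS]
  · refine Measure.le_iff.2 fun S hS => ?_
    rw [Measure.restrict_apply hS, ← measure_inter_conull (chartVolume_compl_source p)]
    exact hle p _

theorem isLocallyFiniteMeasure_riemVolume : IsLocallyFiniteMeasure (riemVolume n M) := by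
  refine ⟨fun x => ?_⟩
  have hx := mem_extChartAt_target (I := 𝓡 n) x
  obtain ⟨r, hr, hrs⟩ := Metric.nhds_basis_closedBall.mem_iff.1
    ((isOpen_extChartAt_target (I := 𝓡 n) x).mem_nhds hx)
  have hcont := (contDiffOn_volDensity (n := n) x).continuousOn.mono hrs
  have hint := hcont.integrableOn_compact (μ := volume) (isCompact_closedBall _ _)
  refine ⟨(extChartAt (𝓡 n) x).source ∩ extChartAt (𝓡 n) x ⁻¹' Metric.ball _ r,
    ((continuousOn_extChartAt x).isOpen_inter_preimage (isOpen_extChartAt_source x)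
      Metric.isOpen_ball).mem_nhds ⟨mem_extChartAt_source x, Metric.mem_ball_self hr⟩, ?_⟩
  have hm : MeasurableSet ((extChartAt (𝓡 n) x).source ∩
      extChartAt (𝓡 n) x ⁻¹' Metric.ball (extChartAt (𝓡 n) x x) r) :=
    ((continuousOn_extChartAt x).isOpen_inter_preimage (isOpen_extChartAt_source x)
      Metric.isOpen_ball).measurableSet
  rw [← Measure.restrict_eq_self (riemVolume n M) (inter_subset_left :
      (extChartAt (𝓡 n) x).source ∩ _ ⊆ (extChartAt (𝓡 n) x).source),
    riemVolume_restrict_source, chartVolume_apply x hm]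
  refine lt_of_le_of_lt ?_ hint.lintegral_lt_top
  refine lintegral_mono_set ?_
  rintro y ⟨hy, hy2, hy3⟩
  rw [mem_preimage, (extChartAt (𝓡 n) x).right_inv hy] at hy3
  exact Metric.ball_subset_closedBall hy3

instance isFiniteMeasure_riemVolume : IsFiniteMeasure (riemVolume n M) := by
  have := isLocallyFiniteMeasure_riemVolume (n := n) (M := M)
  infer_instance

instance isOpenPosMeasure_riemVolume : (riemVolume n M).IsOpenPosMeasure := by
  refine ⟨fun U hU ⟨x, hx⟩ h0 => ?_⟩
  have h1 : chartVolume n x U = 0 := le_antisymm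
    (((le_iSup (chartVolume n) x : chartVolume n x ≤ riemVolume n M) U).trans h0.le) bot_le
  have hopen := (continuousOn_extChartAt_symm (I := 𝓡 n) x).isOpen_inter_preimage
    (isOpen_extChartAt_target x) hU
  rw [chartVolume_apply x hU.measurableSet, lintegral_eq_zero_iff'] at h1
  · have h2 : ∀ᵐ y ∂(volume : Measure (EuclideanSpace ℝ (Fin n))).restrict
        ((extChartAt (𝓡 n) x).target ∩ (extChartAt (𝓡 n) x).symm ⁻¹' U), False := by
      filter_upwards [h1, ae_restrict_mem hopen.measurableSet] with y hy hyU
      exact (ENNReal.ofReal_pos.2 (volDensity_pos hyU.1)).ne' hy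
    rw [ae_iff] at h2
    simp only [not_false_eq_true, Set.ofPred_true, Measure.restrict_apply_univ] at h2
    exact (hopen.measure_pos volume ⟨extChartAt (𝓡 n) x x, mem_extChartAt_target x,
      by simpa using hx⟩).ne' h2
  · exact ((contDiffOn_volDensity (n := n) x).continuousOn.mono inter_subset_left).aemeasurable
      hopen.measurableSet |>.ennreal_ofReal

theorem riemVolume_singleton [T1Space M] (hn : n ≠ 0) (x : M) : riemVolume n M {x} = 0 := by
  rw [← Measure.restrict_eq_self (riemVolume n M)
    (singleton_subset_iff.2 (mem_extChartAt_source (I := 𝓡 n) x)), riemVolume_restrict_source,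
    chartVolume_apply x (measurableSet_singleton x)]
  -- In dimension zero Lebesgue measure is a point mass; a coordinate direction is what excludes
  -- atoms.
  have : Nonempty (Fin n) := ⟨⟨0, Nat.pos_of_ne_zero hn⟩⟩
  refine setLIntegral_measure_zero _ _ ?_
  refine Set.Subsingleton.measure_zero (fun y hy z hz => ?_) _
  exact (extChartAt (𝓡 n) x).symm.injOn hy.1 hz.1 (hy.2.trans hz.2.symm)

theorem setIntegral_source_eq (p : M) {f : M → ℝ} (hf : ContinuousOn f (extChartAt (𝓡 n) p).source) :
    ∫ x in (extChartAt (𝓡 n) p).source, f x ∂(riemVolume n M) =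
      ∫ y in (extChartAt (𝓡 n) p).target, volDensity n p y * f ((extChartAt (𝓡 n) p).symm y) := by
  have hmeas : AEStronglyMeasurable f (chartVolume n p) := by
    rw [← riemVolume_restrict_source]
    exact hf.aestronglyMeasurable (isOpen_extChartAt_source p).measurableSet
  rw [riemVolume_restrict_source]
  rw [chartVolume] at hmeas ⊢
  rw [integral_map (aemeasurable_extChartAt_symm_withDensity p) hmeas,
    integral_withDensity_eq_integral_toReal_smul₀]
  · refine setIntegral_congr_fun (measurableSet_extChartAt_target p) fun y hy => ?_
    simp only [smul_eq_mul]
    rw [ENNReal.toReal_ofReal (volDensity_pos hy).le]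
  · exact ((contDiffOn_volDensity (n := n) p).continuousOn.aemeasurable
      (measurableSet_extChartAt_target p)).ennreal_ofReal
  · simp

end Volume

end RiemGeom

/-! ### Integration by parts in a chart. -/

/-- Since `g` vanishes on `T` off the compact set `K`, its extension by zero is differentiable on
the whole space, and the global integration by parts applies. -/
theorem setIntegral_fderiv_mul_add_eq_zero {E : Type*} [NormedAddCommGroup E] [NormedSpace ℝ E]
    [FiniteDimensional ℝ E] [MeasurableSpace E] [BorelSpace E] {μ : Measure E}
    [μ.IsAddHaarMeasure] {T K : Set E} (hT : IsOpen T) (hK : IsCompact K) (hKT : K ⊆ T)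
    {g W : E → ℝ} (hg : ContDiffOn ℝ 1 g T) (hW : ContDiffOn ℝ 1 W T)
    (hgK : ∀ y ∈ T, y ∉ K → g y = 0) (v : E) :
    IntegrableOn (fun y => fderiv ℝ g y v * W y + g y * fderiv ℝ W y v) T μ ∧
    ∫ y in T, (fderiv ℝ g y v * W y + g y * fderiv ℝ W y v) ∂μ = 0 := by
  classical
  set G : E → ℝ := T.indicator g with hG
  have hGT : ∀ y ∈ T, G =ᶠ[𝓝 y] g := fun y hy => by
    filter_upwards [hT.mem_nhds hy] with z hz
    exact indicator_of_mem hz g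
  have hGK0 : ∀ y, y ∉ K → G y = 0 := fun y hy => by
    by_cases hyT : y ∈ T
    · rw [hG, indicator_of_mem hyT, hgK y hyT hy]
    · exact indicator_of_notMem hyT g
  have hGK : ∀ y, y ∉ K → G =ᶠ[𝓝 y] fun _ => 0 := fun y hy => by
    filter_upwards [hK.isClosed.isOpen_compl.mem_nhds hy] with z hz
    exact hGK0 z hz
  have hdG : Differentiable ℝ G := fun y => by
    by_cases hyT : y ∈ T
    · exact ((hg.differentiableOn one_ne_zero).differentiableAt
        (hT.mem_nhds hyT)).congr_of_eventuallyEq (hGT y hyT)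
    · exact (differentiableAt_const _).congr_of_eventuallyEq (hGK y fun h => hyT (hKT h))
  have hfG : ∀ y ∈ T, fderiv ℝ G y = fderiv ℝ g y := fun y hy => (hGT y hy).fderiv_eq
  have hfK : ∀ y, y ∉ K → fderiv ℝ G y = 0 := fun y hy => by
    rw [(hGK y hy).fderiv_eq]
    simp
  have hsupp : tsupport G ⊆ K := closure_minimal
    (fun y hy => by_contra fun h => hy (hGK0 y h)) hK.isClosed
  have hcg : ContinuousOn g T := hg.continuousOn
  have hcW : ContinuousOn W T := hW.continuousOn
  have hcdg : ContinuousOn (fun y => fderiv ℝ g y v) T :=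
    (hg.continuousOn_fderiv_of_isOpen hT le_rfl).clm_apply continuousOn_const
  have hcdW : ContinuousOn (fun y => fderiv ℝ W y v) T :=
    (hW.continuousOn_fderiv_of_isOpen hT le_rfl).clm_apply continuousOn_const
  have hint : ∀ {f h : E → ℝ}, ContinuousOn h T → (∀ y ∈ T, f y = h y) → (∀ y, y ∉ K → f y = 0) →
      Integrable f μ := by
    intro f h hh hfh hf0
    have h1 : IntegrableOn h K μ := (hh.mono hKT).integrableOn_compact hK
    have h2 : IntegrableOn f K μ :=
      h1.congr_fun (fun y hy => (hfh y (hKT hy)).symm) hK.isClosed.measurableSet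
    exact h2.integrable_of_forall_notMem_eq_zero hf0
  have i1 : Integrable (fun y => fderiv ℝ G y v * W y) μ :=
    hint (hcdg.mul hcW) (fun y hy => by rw [hfG y hy]; rfl) (fun y hy => by simp [hfK y hy])
  have i2 : Integrable (fun y => G y * fderiv ℝ W y v) μ :=
    hint (hcg.mul hcdW) (fun y hy => by rw [(hGT y hy).eq_of_nhds]; rfl)
      (fun y hy => by rw [hGK0 y hy, zero_mul])
  have i3 : Integrable (fun y => G y * W y) μ :=
    hint (hcg.mul hcW) (fun y hy => by rw [(hGT y hy).eq_of_nhds]; rfl)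
      (fun y hy => by rw [hGK0 y hy, zero_mul])
  -- `W` needs no extension: its differentiability is required only on the support of `G`, which
  -- lies in `K`.
  have key := integral_mul_fderiv_eq_neg_fderiv_mul_of_integrable i1 i2 i3
    (fun y _ => hdG y) (fun y hy => (hW.differentiableOn one_ne_zero).differentiableAt
      (hT.mem_nhds (hKT (hsupp hy))))
  have hcongr : EqOn (fun y => fderiv ℝ G y v * W y + G y * fderiv ℝ W y v)
      (fun y => fderiv ℝ g y v * W y + g y * fderiv ℝ W y v) T := fun y hy => by
    simp only [hfG y hy, (hGT y hy).eq_of_nhds]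
  refine ⟨(i1.add i2).integrableOn.congr_fun hcongr hT.measurableSet, ?_⟩
  rw [← setIntegral_congr_fun hT.measurableSet hcongr,
    setIntegral_eq_integral_of_forall_compl_eq_zero, integral_add i1 i2, key, add_neg_cancel]
  intro y hy
  have : y ∉ K := fun h => hy (hKT h)
  simp [hfK y this, hGK0 y this]

theorem continuous_of_continuousOn_of_eq_zero {X : Type*} [TopologicalSpace X] {f : X → ℝ}
    {U K : Set X} (hU : IsOpen U) (hK : IsClosed K) (hKU : K ⊆ U) (hf : ContinuousOn f U)
    (h0 : ∀ x, x ∉ K → f x = 0) : Continuous f := by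
  refine continuous_iff_continuousAt.2 fun x => ?_
  by_cases hx : x ∈ U
  · exact hf.continuousAt (hU.mem_nhds hx)
  · have : f =ᶠ[𝓝 x] fun _ => 0 := by
      filter_upwards [hK.isOpen_compl.mem_nhds fun h => hx (hKU h)] with z hz
      exact h0 z hz
    exact continuousAt_const.congr this.symm

namespace RiemGeom

/-! ### The divergence theorem and Green's formula. -/

section DivergenceTheorem

variable {n : ℕ} {M : Type*} [TopologicalSpace M] [ChartedSpace (EuclideanSpace ℝ (Fin n)) M]
  [IsManifold (𝓡 n) ∞ M] [RiemannianBundle (fun x : M => TangentSpace (𝓡 n) x)]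
  [IsContMDiffRiemannianBundle (𝓡 n) ∞ (EuclideanSpace ℝ (Fin n))
      (fun x : M => TangentSpace (𝓡 n) x)]

theorem continuousOn_differential_field {f : M → ℝ} (hf : Smooth n f)
    {X : (x : M) → TangentSpace (𝓡 n) x} (hX : SmoothField X) (p : M) :
    ContinuousOn (fun x => differential n f x (X x)) (extChartAt (𝓡 n) p).source := by
  have h : ContinuousOn (fun y => ∑ i, coordField n X p y i *
      fderiv ℝ (f ∘ (extChartAt (𝓡 n) p).symm) y (EuclideanSpace.single i (1 : ℝ)))
      (extChartAt (𝓡 n) p).target :=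
    continuousOn_finsetSum _ fun i _ => (hX p i).continuousOn.mul
      (((hf.contDiffOn p).continuousOn_fderiv_of_isOpen (isOpen_extChartAt_target p)
        (by simp)).clm_apply continuousOn_const)
  refine (h.comp (continuousOn_extChartAt p) (extChartAt (𝓡 n) p).mapsTo).congr fun x hx => ?_
  have := differential_field_eq_sum hf X ((extChartAt (𝓡 n) p).map_source hx)
  rw [(extChartAt (𝓡 n) p).left_inv hx] at this
  exact this

theorem continuous_differential_field {f : M → ℝ} (hf : Smooth n f)
    {X : (x : M) → TangentSpace (𝓡 n) x} (hX : SmoothField X) :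
    Continuous (fun x => differential n f x (X x)) :=
  continuous_iff_continuousAt.2 fun p => (continuousOn_differential_field hf hX p).continuousAt
    (extChartAt_source_mem_nhds p)

theorem differential_eq_zero_of_notMem_tsupport {f : M → ℝ} {x : M} (hx : x ∉ tsupport f) :
    differential n f x = 0 := by
  have h : f =ᶠ[𝓝 x] fun _ => 0 := notMem_tsupport_iff_eventuallyEq.1 hx
  have h2 := h.mfderiv_eq (I := 𝓡 n) (I' := 𝓘(ℝ, ℝ))
  exact h2.trans mfderiv_const

theorem differential_add {f g : M → ℝ} (hf : Smooth n f) (hg : Smooth n g) (x : M) :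
    differential n (f + g) x = differential n f x + differential n g x :=
  mfderiv_add (hf.mdifferentiableAt x) (hg.mdifferentiableAt x)

theorem Smooth.finsetSum {ι : Type*} (s : Finset ι) {f : ι → M → ℝ} (hf : ∀ i, Smooth n (f i)) :
    Smooth n (∑ i ∈ s, f i) := by
  classical
  induction s using Finset.induction_on with
  | empty => exact (contMDiff_const : ContMDiff (𝓡 n) 𝓘(ℝ, ℝ) ∞ fun _ : M => (0 : ℝ))
  | insert a s ha ih =>
    rw [Finset.sum_insert ha]
    exact ContMDiff.add (hf a) ih

theorem differential_finsetSum {ι : Type*} (s : Finset ι) {f : ι → M → ℝ}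
    (hf : ∀ i, Smooth n (f i)) (x : M) :
    differential n (∑ i ∈ s, f i) x = ∑ i ∈ s, differential n (f i) x := by
  classical
  induction s using Finset.induction_on with
  | empty => exact (mfderiv_const : mfderiv (𝓡 n) 𝓘(ℝ, ℝ) (fun _ : M => (0 : ℝ)) x = 0)
  | insert a s ha ih =>
    rw [Finset.sum_insert ha, Finset.sum_insert ha, differential_add (hf a) (Smooth.finsetSum s hf),
      ih]

theorem continuousOn_coordDivergence_chart {X : (x : M) → TangentSpace (𝓡 n) x}
    (hX : SmoothField X) (p : M) :
    ContinuousOn (fun x => coordDivergence X p (extChartAt (𝓡 n) p x))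
      (extChartAt (𝓡 n) p).source :=
  (continuousOn_coordDivergence hX p).comp (continuousOn_extChartAt p)
    (extChartAt (𝓡 n) p).mapsTo

theorem continuousOn_weak_divergence {X : (x : M) → TangentSpace (𝓡 n) x} (hX : SmoothField X)
    {χ : M → ℝ} (hχ : Smooth n χ) (p : M) :
    ContinuousOn (fun x => differential n χ x (X x) +
      χ x * coordDivergence X p (extChartAt (𝓡 n) p x)) (extChartAt (𝓡 n) p).source :=
  (continuousOn_differential_field hχ hX p).add
    (hχ.continuous.continuousOn.mul (continuousOn_coordDivergence_chart hX p))

variable [MeasurableSpace M] [BorelSpace M] [CompactSpace M] [T2Space M]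

theorem setIntegral_source_weak_divergence {X : (x : M) → TangentSpace (𝓡 n) x}
    (hX : SmoothField X) {χ : M → ℝ} (hχ : Smooth n χ) {p : M}
    (hsupp : tsupport χ ⊆ (extChartAt (𝓡 n) p).source) :
    ∫ x in (extChartAt (𝓡 n) p).source, (differential n χ x (X x) +
      χ x * coordDivergence X p (extChartAt (𝓡 n) p x)) ∂(riemVolume n M) = 0 := by
  rw [setIntegral_source_eq p (continuousOn_weak_divergence hX hχ p)]
  set T := (extChartAt (𝓡 n) p).target
  set K := extChartAt (𝓡 n) p '' tsupport χ
  have hK : IsCompact K := (isClosed_tsupport χ).isCompact.image_of_continuousOn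
    ((continuousOn_extChartAt p).mono hsupp)
  have hKT : K ⊆ T := by
    rintro _ ⟨x, hx, rfl⟩
    exact (extChartAt (𝓡 n) p).map_source (hsupp hx)
  have hsum := fun i => setIntegral_fderiv_mul_add_eq_zero
    (μ := (volume : Measure (EuclideanSpace ℝ (Fin n))))
    (isOpen_extChartAt_target p) hK hKT ((hχ.contDiffOn p).of_le (by simp))
    ((contDiffOn_density_mul hX p i).of_le (by simp))
    (fun y hy hyK => image_eq_zero_of_notMem_tsupport (f := χ) fun h =>
      hyK ⟨_, h, (extChartAt (𝓡 n) p).right_inv hy⟩) (EuclideanSpace.single i (1 : ℝ))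
  rw [setIntegral_congr_fun (measurableSet_extChartAt_target p) (g := fun y => ∑ i,
    (fderiv ℝ (χ ∘ (extChartAt (𝓡 n) p).symm) y (EuclideanSpace.single i (1 : ℝ)) *
      (volDensity n p y * coordField n X p y i) + (χ ∘ (extChartAt (𝓡 n) p).symm) y *
      fderiv ℝ (fun y => volDensity n p y * coordField n X p y i) y
        (EuclideanSpace.single i (1 : ℝ))))]
  · rw [integral_finsetSum _ fun i _ => (hsum i).1]
    exact Finset.sum_eq_zero fun i _ => (hsum i).2
  · intro y hy
    simp only []
    rw [differential_field_eq_sum hχ X hy, (extChartAt (𝓡 n) p).right_inv hy, coordDivergence,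
      Finset.sum_add_distrib, ← Finset.mul_sum, mul_add, Finset.mul_sum]
    congr 1
    · exact Finset.sum_congr rfl fun i _ => by ring
    · have := (volDensity_pos hy).ne'
      rw [Function.comp_apply]
      field_simp

theorem integral_weak_divergence {X : (x : M) → TangentSpace (𝓡 n) x}
    (hX : SmoothField X) {χ : M → ℝ} (hχ : Smooth n χ) {p : M}
    (hsupp : tsupport χ ⊆ (extChartAt (𝓡 n) p).source) :
    Integrable (fun x => differential n χ x (X x) +
      χ x * coordDivergence X p (extChartAt (𝓡 n) p x)) (riemVolume n M) ∧
    ∫ x, (differential n χ x (X x) +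
      χ x * coordDivergence X p (extChartAt (𝓡 n) p x)) ∂(riemVolume n M) = 0 := by
  -- Outside the chart domain `coordDivergence` has a meaningless value, which is killed by `χ`.
  have h0 : ∀ x, x ∉ tsupport χ → differential n χ x (X x) +
      χ x * coordDivergence X p (extChartAt (𝓡 n) p x) = 0 := fun x hx => by
    rw [differential_eq_zero_of_notMem_tsupport hx, image_eq_zero_of_notMem_tsupport hx, zero_mul,
      add_zero]
    rfl
  constructor
  · exact (continuous_of_continuousOn_of_eq_zero (isOpen_extChartAt_source p) (isClosed_tsupport χ)
      hsupp (continuousOn_weak_divergence hX hχ p) h0).integrable_of_hasCompactSupport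
      (HasCompactSupport.of_compactSpace _)
  · rw [← setIntegral_eq_integral_of_forall_compl_eq_zero fun x hx => h0 x fun h => hx (hsupp h)]
    exact setIntegral_source_weak_divergence hX hχ hsupp

/-- On the overlap the two coordinate divergences have the same integral against every test
function, because the weak identity holds in each chart for the same measure. They agree almost
everywhere by the fundamental lemma of the calculus of variations, and everywhere by continuity, as
open sets have positive volume. -/
theorem coordDivergence_eq_of_mem {X : (x : M) → TangentSpace (𝓡 n) x} (hX : SmoothField X)
    {p q x : M} (hp : x ∈ (extChartAt (𝓡 n) p).source) (hq : x ∈ (extChartAt (𝓡 n) q).source) :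
    coordDivergence X p (extChartAt (𝓡 n) p x) = coordDivergence X q (extChartAt (𝓡 n) q x) := by
  set U := (extChartAt (𝓡 n) p).source ∩ (extChartAt (𝓡 n) q).source with hUdef
  have hU : IsOpen U := (isOpen_extChartAt_source p).inter (isOpen_extChartAt_source q)
  have hcp := (continuousOn_coordDivergence_chart hX p).mono
    (inter_subset_left : U ⊆ (extChartAt (𝓡 n) p).source)
  have hcq := (continuousOn_coordDivergence_chart hX q).mono
    (inter_subset_right : U ⊆ (extChartAt (𝓡 n) q).source)
  have : SecondCountableTopology M :=
    ChartedSpace.secondCountable_of_sigmaCompact (EuclideanSpace ℝ (Fin n)) M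
  have h := hU.ae_eq_zero_of_integral_contMDiff_smul_eq_zero (𝓡 n) (μ := riemVolume n M)
    ((hcp.sub hcq).locallyIntegrableOn hU.measurableSet) fun g hg _ hgU => by
      have hi := integral_weak_divergence hX hg (hgU.trans inter_subset_left)
      have hj := integral_weak_divergence hX hg (hgU.trans inter_subset_right)
      rw [← sub_zero (0 : ℝ)]
      nth_rewrite 1 [← hi.2]
      rw [← hj.2, ← integral_sub hi.1 hj.1]
      refine integral_congr_ae (Eventually.of_forall fun z => ?_)
      simp only [smul_eq_mul, Pi.sub_apply]
      ring
  have h2 := Measure.eqOn_open_of_ae_eq (μ := riemVolume n M)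
    ((ae_restrict_iff' hU.measurableSet).2 (by
      filter_upwards [h] with z hz hzU
      exact sub_eq_zero.1 (hz hzU))) hU hcp hcq
  exact h2 ⟨hp, hq⟩

theorem divergence_eq_of_mem {X : (x : M) → TangentSpace (𝓡 n) x} (hX : SmoothField X)
    {p x : M} (hp : x ∈ (extChartAt (𝓡 n) p).source) :
    divergence n X x = coordDivergence X p (extChartAt (𝓡 n) p x) :=
  coordDivergence_eq_of_mem hX (mem_extChartAt_source x) hp

theorem continuous_divergence {X : (x : M) → TangentSpace (𝓡 n) x} (hX : SmoothField X) :
    Continuous (divergence n X) :=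
  continuous_iff_continuousAt.2 fun p =>
    ((continuousOn_coordDivergence_chart hX p).congr fun _ hx =>
      divergence_eq_of_mem hX hx).continuousAt (extChartAt_source_mem_nhds p)

theorem integrable_of_continuous {f : M → ℝ} (hf : Continuous f) :
    Integrable f (riemVolume n M) :=
  hf.integrable_of_hasCompactSupport (HasCompactSupport.of_compactSpace _)

/-- A partition of unity subordinate to finitely many charts splits `χ` into pieces, each covered by
the identity in one chart; chart independence turns `coordDivergence` into `divergence`. -/
theorem integral_differential_add_mul_divergence {X : (x : M) → TangentSpace (𝓡 n) x}
    (hX : SmoothField X) {χ : M → ℝ} (hχ : Smooth n χ) :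
    ∫ x, (differential n χ x (X x) + χ x * divergence n X x) ∂(riemVolume n M) = 0 := by
  obtain ⟨t, ht⟩ := exists_finset_iUnion_source n M
  obtain ⟨f, hf⟩ := SmoothPartitionOfUnity.exists_isSubordinate (𝓡 n) (s := (univ : Set M))
    isClosed_univ (fun p : t => (extChartAt (𝓡 n) (p : M)).source)
    (fun p => isOpen_extChartAt_source _) (fun x _ => by
      have hx : x ∈ ⋃ p ∈ t, (extChartAt (𝓡 n) p).source := ht ▸ mem_univ x
      simp only [mem_iUnion] at hx ⊢
      obtain ⟨q, hq, hxq⟩ := hx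
      exact ⟨⟨q, hq⟩, hxq⟩)
  have hsmooth : ∀ p : t, Smooth n (fun x => f p x * χ x) := fun p =>
    Smooth.mul (f p).contMDiff hχ
  have hsupp : ∀ p : t, tsupport (fun x => f p x * χ x) ⊆ (extChartAt (𝓡 n) (p : M)).source :=
    fun p => (tsupport_mul_subset_left).trans (hf p)
  have hcont : ∀ p : t, Continuous fun x => differential n (fun x => f p x * χ x) x (X x) +
      f p x * χ x * divergence n X x := fun p =>
    (continuous_differential_field (hsmooth p) hX).add
      ((hsmooth p).continuous.mul (continuous_divergence hX))
  have hzero : ∀ p : t, ∫ x, (differential n (fun x => f p x * χ x) x (X x) +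
      f p x * χ x * divergence n X x) ∂(riemVolume n M) = 0 := fun p => by
    rw [← (integral_weak_divergence hX (hsmooth p) (hsupp p)).2]
    refine integral_congr_ae (Eventually.of_forall fun x => ?_)
    simp only []
    by_cases hx : x ∈ tsupport (fun x => f p x * χ x)
    · rw [divergence_eq_of_mem hX (hsupp p hx)]
    · have : f p x * χ x = 0 := image_eq_zero_of_notMem_tsupport (f := fun x => f p x * χ x) hx
      rw [this, zero_mul, zero_mul]
  have hsum : χ = ∑ p : t, fun x => f p x * χ x := by
    funext x
    rw [Finset.sum_apply, ← Finset.sum_mul, ← finsum_eq_sum_of_fintype,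
      f.sum_eq_one (mem_univ x), one_mul]
  have hd : ∀ x, differential n χ x = ∑ p : t, differential n (fun x => f p x * χ x) x := fun x => by
    rw [← differential_finsetSum _ hsmooth, ← hsum]
  calc ∫ x, (differential n χ x (X x) + χ x * divergence n X x) ∂(riemVolume n M)
      = ∫ x, ∑ p : t, (differential n (fun x => f p x * χ x) x (X x) +
          f p x * χ x * divergence n X x) ∂(riemVolume n M) := by
        refine integral_congr_ae (Eventually.of_forall fun x => ?_)
        simp only []
        rw [Finset.sum_add_distrib, ← Finset.sum_mul, hd]
        congr 1
        · exact sum_apply _ _ _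
        · conv_lhs => rw [hsum]
          rw [Finset.sum_apply]
    _ = 0 := by
        rw [integral_finsetSum _ fun p _ => integrable_of_continuous (hcont p)]
        exact Finset.sum_eq_zero fun p _ => hzero p

theorem continuous_laplacian {f : M → ℝ} (hf : Smooth n f) : Continuous (laplacian n f) :=
  (continuous_divergence hf.smoothField_grad).neg

theorem continuous_norm_grad_sq {f : M → ℝ} (hf : Smooth n f) :
    Continuous fun x => ‖grad n f x‖ ^ 2 :=
  (continuous_differential_field hf hf.smoothField_grad).congr fun x => differential_grad_self f x

/-- The divergence theorem with `X = ∇f` and `χ = f`. -/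
theorem integral_norm_grad_sq {f : M → ℝ} (hf : Smooth n f) :
    ∫ x, ‖grad n f x‖ ^ 2 ∂(riemVolume n M) = ∫ x, f x * laplacian n f x ∂(riemVolume n M) := by
  have h := integral_differential_add_mul_divergence hf.smoothField_grad hf
  simp only [differential_grad_self] at h
  rw [integral_add (integrable_of_continuous (continuous_norm_grad_sq hf))
    (integrable_of_continuous (f := fun x => f x * divergence n (grad n f) x)
      (hf.continuous.mul (continuous_divergence hf.smoothField_grad)))] at h
  simp only [laplacian, mul_neg, integral_neg]
  linarith

end DivergenceTheorem

end RiemGeom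

/-! ### Concentration of densities on the zero set of a continuous function. -/

section Concentration

variable {X : Type*} [TopologicalSpace X] [CompactSpace X] [MeasurableSpace X] [BorelSpace X]
  {μ : Measure X}

theorem Continuous.mul_integrable_of_compactSpace {f ρ : X → ℝ} (hf : Continuous f)
    (hρ : Integrable ρ μ) : Integrable (fun x => f x * ρ x) μ := by
  obtain ⟨C, hC⟩ := isCompact_univ.exists_bound_of_continuousOn hf.continuousOn
  exact hρ.bdd_mul hf.aestronglyMeasurable
    (Eventually.of_forall fun x => hC x (mem_univ x))

/-- On the compact set `{|h| ≥ η}` the function `S` has no zero, hence a positive minimum; `K` is a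
bound of `|h|` divided by that minimum. -/
theorem exists_abs_le_add_mul {S h : X → ℝ} (hS : Continuous S) (hS0 : ∀ x, 0 ≤ S x)
    (hh : Continuous h) (hzero : ∀ x, S x = 0 → h x = 0) {η : ℝ} (hη : 0 < η) :
    ∃ K, 0 ≤ K ∧ ∀ x, |h x| ≤ η + K * S x := by
  set T : Set X := {x | η ≤ |h x|} with hT
  have hTc : IsCompact T := (isClosed_le continuous_const hh.abs).isCompact
  obtain ⟨B, hB⟩ := isCompact_univ.exists_bound_of_continuousOn hh.continuousOn
  rcases T.eq_empty_or_nonempty with hTe | hTn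
  · refine ⟨0, le_rfl, fun x => ?_⟩
    have : x ∉ T := hTe ▸ notMem_empty x
    have h2 : |h x| < η := not_le.1 this
    simpa using h2.le
  · obtain ⟨x₀, hx₀, hmin⟩ := hTc.exists_isMinOn hTn hS.continuousOn
    have hpos : 0 < S x₀ := (hS0 x₀).lt_of_ne fun h0 => by
      have h1 : η ≤ |h x₀| := hx₀
      rw [hzero x₀ h0.symm, abs_zero] at h1
      linarith
    have hB0 : 0 ≤ B := (norm_nonneg _).trans (hB x₀ (mem_univ _))
    refine ⟨B / S x₀, by positivity, fun x => ?_⟩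
    by_cases hx : x ∈ T
    · have h1 : S x₀ ≤ S x := hmin hx
      have h2 : |h x| ≤ B := hB x (mem_univ x)
      have h3 : B ≤ B / S x₀ * S x := by
        rw [div_mul_eq_mul_div, le_div_iff₀ hpos]
        exact mul_le_mul_of_nonneg_left h1 hB0
      linarith
    · have h1 : |h x| < η := not_le.1 hx
      have h2 : 0 ≤ B / S x₀ * S x := mul_nonneg (by positivity) (hS0 x)
      linarith

theorem tendsto_integral_mul_zero {ι : Type*} {l : Filter ι} {S : X → ℝ} (hS : Continuous S)
    (hS0 : ∀ x, 0 ≤ S x) {ρ : ι → X → ℝ} (hρ0 : ∀ᶠ i in l, ∀ x, 0 ≤ ρ i x)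
    (hρ1 : ∀ᶠ i in l, ∫ x, ρ i x ∂μ = 1)
    (hlim : Tendsto (fun i => ∫ x, S x * ρ i x ∂μ) l (𝓝 0)) {h : X → ℝ} (hh : Continuous h)
    (hzero : ∀ x, S x = 0 → h x = 0) : Tendsto (fun i => ∫ x, h x * ρ i x ∂μ) l (𝓝 0) := by
  refine Metric.tendsto_nhds.2 fun η hη => ?_
  obtain ⟨K, hK, hbound⟩ := exists_abs_le_add_mul hS hS0 hh hzero (half_pos hη)
  have hlim2 : Tendsto (fun i => η / 2 + K * ∫ x, S x * ρ i x ∂μ) l (𝓝 (η / 2 + K * 0)) :=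
    (hlim.const_mul K).const_add _
  have hev := hlim2.eventually (gt_mem_nhds (show η / 2 + K * 0 < η by linarith))
  filter_upwards [hev, hρ0, hρ1] with i hi h0 h1
  -- Integrability is implicit in the normalization: a non-integrable density would have integral
  -- `0`, not `1`.
  have hint : Integrable (ρ i) μ := by
    by_contra hc
    rw [integral_undef hc] at h1
    exact zero_ne_one h1
  rw [Real.dist_eq, sub_zero]
  refine lt_of_le_of_lt ?_ hi
  have i1 := hS.mul_integrable_of_compactSpace hint
  calc |∫ x, h x * ρ i x ∂μ| ≤ ∫ x, |h x * ρ i x| ∂μ := abs_integral_le_integral_abs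
    _ ≤ ∫ x, (η / 2 * ρ i x + K * (S x * ρ i x)) ∂μ := by
        refine integral_mono (hh.mul_integrable_of_compactSpace hint).abs
          ((hint.const_mul _).add (i1.const_mul _)) fun x => ?_
        simp only []
        rw [abs_mul, abs_of_nonneg (h0 x)]
        have := mul_le_mul_of_nonneg_right (hbound x) (h0 x)
        linarith
    _ = η / 2 + K * ∫ x, S x * ρ i x ∂μ := by
        rw [integral_add (hint.const_mul _) (i1.const_mul _), integral_const_mul,
          integral_const_mul, h1, mul_one]

theorem exists_continuous_eq_one_of_notMem [T2Space X] {P : X} {F : Set X} (hF : IsClosed F)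
    (hP : P ∉ F) : ∃ χ : X → ℝ, Continuous χ ∧ χ P = 1 ∧ (∀ x ∈ F, χ x = 0) ∧
      ∀ x, 0 ≤ χ x ∧ χ x ≤ 1 := by
  obtain ⟨f, hf0, hf1, hf⟩ := exists_continuous_zero_one_of_isClosed hF
    (isClosed_singleton (x := P)) (disjoint_singleton_right.2 hP)
  exact ⟨f, f.continuous, hf1 (mem_singleton P), fun x hx => hf0 hx, fun x => hf x⟩

/-- Let `χ P` be a cutoff equal to `1` at `P` and `0` at the other points of `Z`. For continuous
`f`, the difference `f - ∑ f(P) χ_P` vanishes on the zeros of `S`, so its integrals tend to `0`.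
Only the finitely many numbers `∫ χ_P ρ_k`, all in `[0,1]`, remain to be made convergent;
finite-dimensional compactness does it for all `f` at once. -/
theorem exists_subseq_tendsto_sum [T2Space X] {S : X → ℝ} (hS : Continuous S)
    (hS0 : ∀ x, 0 ≤ S x) {Z : Finset X} (hZ : ∀ x, S x = 0 → x ∈ Z) {ρ : ℕ → X → ℝ}
    (hρ0 : ∀ k x, 0 ≤ ρ k x) (hρ1 : ∀ k, ∫ x, ρ k x ∂μ = 1)
    (hlim : Tendsto (fun k => ∫ x, S x * ρ k x ∂μ) atTop (𝓝 0)) :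
    ∃ (s : ℕ → ℕ) (coef : X → ℝ), StrictMono s ∧ ∑ P ∈ Z, coef P ^ 2 = 1 ∧
      ∀ f : X → ℝ, Continuous f →
        Tendsto (fun k => ∫ x, f x * ρ (s k) x ∂μ) atTop (𝓝 (∑ P ∈ Z, coef P ^ 2 * f P)) := by
  classical
  have hint : ∀ k, Integrable (ρ k) μ := fun k => by
    by_contra hc
    have := hρ1 k
    rw [integral_undef hc] at this
    exact zero_ne_one this
  have hχ : ∀ P : X, ∃ χ : X → ℝ, Continuous χ ∧ χ P = 1 ∧
      (∀ x ∈ ((Z.erase P : Finset X) : Set X), χ x = 0) ∧ ∀ x, 0 ≤ χ x ∧ χ x ≤ 1 := fun P =>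
    exists_continuous_eq_one_of_notMem (Finset.finite_toSet _).isClosed (by simp)
  choose χ hχc hχP hχ0 hχb using hχ
  let w : ℕ → Z → ℝ := fun k P => ∫ x, χ P x * ρ k x ∂μ
  have hw : ∀ k, w k ∈ Set.univ.pi fun _ : Z => Icc (0 : ℝ) 1 := fun k P _ => by
    constructor
    · exact integral_nonneg fun x => mul_nonneg (hχb P x).1 (hρ0 k x)
    · rw [← hρ1 k]
      refine integral_mono ((hχc P).mul_integrable_of_compactSpace (hint k)) (hint k) fun x => ?_
      exact mul_le_of_le_one_left (hρ0 k x) (hχb P x).2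
  obtain ⟨a, ha, s, hs, hlimw⟩ :=
    (isCompact_univ_pi fun _ : Z => isCompact_Icc (a := (0 : ℝ)) (b := 1)).tendsto_subseq hw
  have ha0 : ∀ P, 0 ≤ a P := fun P => (ha P (mem_univ P)).1
  let coef : X → ℝ := fun P => if hP : P ∈ Z then Real.sqrt (a ⟨P, hP⟩) else 0
  have hcoef : ∀ P : Z, coef P ^ 2 = a P := fun P => by
    simp only [coef, P.2, dif_pos, Subtype.coe_eta]
    exact Real.sq_sqrt (ha0 P)
  have hmain : ∀ f : X → ℝ, Continuous f →
      Tendsto (fun k => ∫ x, f x * ρ (s k) x ∂μ) atTop (𝓝 (∑ P ∈ Z, coef P ^ 2 * f P)) := by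
    intro f hf
    have hhc : Continuous fun x => f x - ∑ P ∈ Z, f P * χ P x :=
      hf.sub (continuous_finsetSum _ fun P _ => continuous_const.mul (hχc P))
    have hh0 : ∀ x, S x = 0 → f x - ∑ P ∈ Z, f P * χ P x = 0 := fun x hx => by
      rw [Finset.sum_eq_single_of_mem x (hZ x hx), hχP, mul_one, sub_self]
      intro P _ hPx
      rw [hχ0 P x, mul_zero]
      simpa using ⟨hZ x hx, hPx.symm⟩
    have h1 := tendsto_integral_mul_zero hS hS0 (Eventually.of_forall fun k => hρ0 (s k))
      (Eventually.of_forall fun k => hρ1 (s k)) (hlim.comp hs.tendsto_atTop) hhc hh0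
    have h2 : Tendsto (fun k => ∑ P : Z, f P * w (s k) P) atTop (𝓝 (∑ P : Z, f P * a P)) :=
      tendsto_finsetSum _ fun P _ => ((tendsto_pi_nhds.1 hlimw) P).const_mul _
    have h3 := h1.add h2
    have e1 : ∑ P ∈ Z, coef P ^ 2 * f P = 0 + ∑ P : Z, f P * a P := by
      rw [zero_add, ← Finset.sum_coe_sort Z]
      exact Finset.sum_congr rfl fun P _ => by rw [hcoef, mul_comm]
    rw [e1]
    refine h3.congr fun k => ?_
    have hsc : Continuous fun x => ∑ P ∈ Z, f P * χ P x :=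
      continuous_finsetSum _ fun P _ => continuous_const.mul (hχc P)
    have e2 : ∑ P : Z, f P * w (s k) P =
        ∫ x, (∑ P ∈ Z, f P * χ P x) * ρ (s k) x ∂μ := by
      simp only [Finset.sum_mul, mul_assoc]
      rw [integral_finsetSum _ fun P _ =>
        ((hχc P).mul_integrable_of_compactSpace (hint (s k))).const_mul (f P),
        ← Finset.sum_coe_sort Z]
      refine Finset.sum_congr rfl fun P _ => ?_
      rw [integral_const_mul]
    rw [e2, ← integral_add (hhc.mul_integrable_of_compactSpace (hint (s k)))
      (hsc.mul_integrable_of_compactSpace (hint (s k)))]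
    exact integral_congr_ae (Eventually.of_forall fun x => by ring)
  refine ⟨s, coef, hs, ?_, hmain⟩
  -- Testing with the constant `1` shows that no mass is lost.
  have h1 := hmain (fun _ => 1) continuous_const
  simp only [one_mul, hρ1, mul_one] at h1
  exact tendsto_nhds_unique h1 tendsto_const_nhds

/-- The indicator of `B` lies between the continuous functions `χ` and `χ + (1 - χ) ξ`, with `χ`
zero off `B`, and `ξ` equal to `1` on `C` and `0` on the rest of `Z`. Both take the value `1` at `P`
and `0` at the other points of `Z`, so both limits are the weight of `P`. -/
theorem tendsto_setIntegral_of_tendsto_sum [T2Space X] {Z : Finset X} {ρ : ℕ → X → ℝ}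
    {coef : X → ℝ} (hρ0 : ∀ k x, 0 ≤ ρ k x) (hint : ∀ k, Integrable (ρ k) μ)
    (hlim : ∀ f : X → ℝ, Continuous f →
        Tendsto (fun k => ∫ x, f x * ρ k x ∂μ) atTop (𝓝 (∑ P ∈ Z, coef P ^ 2 * f P)))
    {P : X} (hP : P ∈ Z) {B C : Set X} (hB : IsOpen B) (hPB : P ∈ B) (hC : IsClosed C)
    (hBC : B ⊆ C) (hCZ : ∀ Q ∈ Z, Q ∈ C → Q = P) :
    Tendsto (fun k => ∫ x in B, ρ k x ∂μ) atTop (𝓝 (coef P ^ 2)) := by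
  classical
  obtain ⟨χ, hχc, hχP, hχ0, hχb⟩ := exists_continuous_eq_one_of_notMem hB.isClosed_compl
    (not_not.2 hPB : P ∉ Bᶜ)
  obtain ⟨ξ, hξ0, hξ1, hξb⟩ := exists_continuous_zero_one_of_isClosed
    (Finset.finite_toSet (Z.erase P)).isClosed hC (Set.disjoint_left.2 fun Q hQ hQC => by
      have := Finset.mem_erase.1 (Finset.mem_coe.1 hQ)
      exact this.1 (hCZ Q this.2 hQC))
  have hχZ : ∀ Q ∈ Z, Q ≠ P → χ Q = 0 := fun Q hQ hQP =>
    hχ0 Q fun hQB => hQP (hCZ Q hQ (hBC hQB))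
  have h1 := hlim χ hχc
  have hc2 : Continuous fun x => χ x + (1 - χ x) * ξ x :=
    hχc.add ((continuous_const.sub hχc).mul ξ.continuous)
  have h2 := hlim _ hc2
  rw [Finset.sum_eq_single_of_mem P hP fun Q hQ hQP => by rw [hχZ Q hQ hQP, mul_zero], hχP,
    mul_one] at h1
  rw [Finset.sum_eq_single_of_mem P hP fun Q hQ hQP => by
      have : ξ Q = 0 := hξ0 (Finset.mem_coe.2 (Finset.mem_erase.2 ⟨hQP, hQ⟩))
      rw [hχZ Q hQ hQP, this, mul_zero, add_zero, mul_zero], hχP, sub_self, zero_mul, add_zero,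
    mul_one] at h2
  refine tendsto_of_tendsto_of_tendsto_of_le_of_le h1 h2 (fun k => ?_) (fun k => ?_)
  · simp only []
    rw [← integral_indicator hB.measurableSet]
    refine integral_mono (hχc.mul_integrable_of_compactSpace (hint k))
      ((hint k).indicator hB.measurableSet) fun x => ?_
    by_cases hx : x ∈ B
    · simp only [indicator_of_mem hx]
      exact mul_le_of_le_one_left (hρ0 k x) (hχb x).2
    · simp only [indicator_of_notMem hx, hχ0 x hx, zero_mul, le_refl]
  · simp only []
    rw [← integral_indicator hB.measurableSet]
    refine integral_mono ((hint k).indicator hB.measurableSet)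
      (hc2.mul_integrable_of_compactSpace (hint k)) fun x => ?_
    by_cases hx : x ∈ B
    · have h3 : ξ x = 1 := hξ1 (hBC hx)
      simp only [indicator_of_mem hx, h3, mul_one, add_sub_cancel, one_mul, le_refl]
    · simp only [indicator_of_notMem hx, hχ0 x hx, zero_add, sub_zero, one_mul]
      exact mul_nonneg (hξb x).1 (hρ0 k x)

/-- The inequality is strict so that even the closed balls contain no second point of the finite
set. -/
theorem exists_pos_forall_lt_edist {Y : Type*} [EMetricSpace Y] (Z : Finset Y) :
    ∃ δ₀ > 0, ∀ δ : ℝ, 0 < δ → δ < δ₀ → ∀ P ∈ Z, ∀ Q ∈ Z, Q ≠ P →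
      ENNReal.ofReal δ < edist Q P := by
  have h : ∀ᶠ δ : ℝ in 𝓝[>] 0, ∀ P ∈ Z, ∀ Q ∈ Z, Q ≠ P → ENNReal.ofReal δ < edist Q P := by
    rw [Filter.eventually_all_finset]
    intro P _
    rw [Filter.eventually_all_finset]
    intro Q _
    by_cases hQP : Q = P
    · exact Eventually.of_forall fun _ h => absurd hQP h
    · have ht : Tendsto ENNReal.ofReal (𝓝[>] 0) (𝓝 0) := by
        have := (ENNReal.continuous_ofReal.tendsto 0).mono_left
          (nhdsWithin_le_nhds (s := Ioi (0 : ℝ)))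
        rwa [ENNReal.ofReal_zero] at this
      filter_upwards [ht.eventually (gt_mem_nhds (edist_pos.2 hQP))] with δ hδ _ using hδ
  obtain ⟨δ₀, hδ₀, hsub⟩ := mem_nhdsGT_iff_exists_Ioo_subset.1 h
  exact ⟨δ₀, hδ₀, fun δ h1 h2 => hsub ⟨h1, h2⟩⟩

end Concentration

/-! ### The variational problem as the parameter tends to zero. -/

namespace RiemGeom

/-- Through this identity the weight `e^{-φ/ε} u²` is the square of `uψ`, so facts about minimizers
apply to the normalized measures. -/
theorem gauge_sq {M : Type*} (φ : M → ℝ) (ε : ℝ) (x : M) :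
    gauge φ ε x ^ 2 = Real.exp (-φ x / ε) := by
  rw [gauge, sq, ← Real.exp_add]
  congr 1
  rw [mul_comm 2 ε, ← div_div, add_halves]

theorem integral_densityMeasure {M : Type*} [MeasurableSpace M] {μ : Measure M} {w : M → ℝ}
    (hw : AEMeasurable w μ) (hw0 : ∀ x, 0 ≤ w x) (f : M → ℝ) :
    ∫ x, f x ∂(densityMeasure μ w) = ∫ x, f x * w x ∂μ := by
  rw [densityMeasure, integral_withDensity_eq_integral_toReal_smul₀ hw.ennreal_ofReal (by simp)]
  refine integral_congr_ae (Eventually.of_forall fun x => ?_)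
  simp only [smul_eq_mul]
  rw [ENNReal.toReal_ofReal (hw0 x), mul_comm]

instance isFiniteMeasure_diracSum {M : Type*} [MeasurableSpace M] (S : Finset M) (coef : M → ℝ) :
    IsFiniteMeasure (diracSum S coef) := by
  refine ⟨?_⟩
  simp only [diracSum, Measure.coe_finsetSum, Finset.sum_apply, Measure.smul_apply, smul_eq_mul]
  exact ENNReal.sum_lt_top.2 fun P _ => by simp

theorem integral_diracSum {M : Type*} [TopologicalSpace M] [CompactSpace M] [MeasurableSpace M]
    [BorelSpace M] (S : Finset M) (coef : M → ℝ) {f : M → ℝ} (hf : Continuous f) :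
    ∫ x, f x ∂(diracSum S coef) = ∑ P ∈ S, coef P ^ 2 * f P := by
  have hint : ∀ (ν : Measure M) [IsFiniteMeasure ν], Integrable f ν := fun ν _ =>
    hf.integrable_of_hasCompactSupport (HasCompactSupport.of_compactSpace _)
  rw [diracSum, integral_finsetSum_measure fun P _ => (hint _).smul_measure (by simp)]
  refine Finset.sum_congr rfl fun P _ => ?_
  rw [integral_smul_measure, integral_dirac' _ _ hf.stronglyMeasurable,
    ENNReal.toReal_ofReal (sq_nonneg _), smul_eq_mul]

section Variational

variable {n : ℕ} {M : Type*} [TopologicalSpace M] [ChartedSpace (EuclideanSpace ℝ (Fin n)) M]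
  [IsManifold (𝓡 n) ∞ M] [RiemannianBundle (fun x : M => TangentSpace (𝓡 n) x)]

theorem potential_eq (φ c : M → ℝ) (ε : ℝ) (x : M) :
    potential n φ c ε x = ‖grad n φ x‖ ^ 2 / 4 + ε * (c x + laplacian n φ x / 2) := by
  rw [potential]
  ring

theorem norm_grad_sq_eq_zero_iff (φ : M → ℝ) (x : M) :
    ‖grad n φ x‖ ^ 2 = 0 ↔ x ∈ criticalPoints n φ := by
  rw [← grad_eq_zero_iff, sq_eq_zero_iff, norm_eq_zero]

theorem tendsto_potential_of_mem_criticalPoints {φ c : M → ℝ} {x : M}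
    (hx : x ∈ criticalPoints n φ) :
    Tendsto (fun ε => potential n φ c ε x) (𝓝[>] 0) (𝓝 0) := by
  simp only [potential_eq, (norm_grad_sq_eq_zero_iff φ x).2 hx, zero_div, zero_add]
  have h : Continuous fun ε : ℝ => ε * (c x + laplacian n φ x / 2) := by fun_prop
  have h2 := (h.tendsto 0).mono_left (nhdsWithin_le_nhds (s := Ioi (0 : ℝ)))
  rwa [zero_mul] at h2

/-- Fermat's rule in the chart at `p`, transported back because every tangent vector at `p` is a
value of `symmDeriv`. -/
theorem differential_eq_zero_of_forall_le {φ : M → ℝ} (hφ : Smooth n φ) {p : M}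
    (hp : ∀ x, φ p ≤ φ x) : differential n φ p = 0 := by
  have hy := mem_extChartAt_target (I := 𝓡 n) p
  have hmin : IsLocalMin (φ ∘ (extChartAt (𝓡 n) p).symm) (extChartAt (𝓡 n) p p) :=
    Eventually.of_forall fun y => by
      simp only [Function.comp_apply, extChartAt_to_inv]
      exact hp _
  have h : ∀ v, differential n φ p (symmDeriv p (extChartAt (𝓡 n) p p) v) = 0 := fun v => by
    have h1 := differential_symmDeriv hy (hφ.mdifferentiableAt _) v
    rw [hmin.fderiv_eq_zero, extChartAt_to_inv] at h1
    exact h1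
  refine ContinuousLinearMap.ext fun w => ?_
  have h2 := DFunLike.congr_fun (symmDeriv_comp_chartDeriv hy) w
  have h3 := h (chartDeriv p ((extChartAt (𝓡 n) p).symm (extChartAt (𝓡 n) p p)) w)
  exact (congrArg (differential n φ p) h2).symm.trans h3

theorem criticalPoints_nonempty [CompactSpace M] [Nonempty M] {φ : M → ℝ} (hφ : Smooth n φ) :
    (criticalPoints n φ).Nonempty := by
  obtain ⟨p, -, hp⟩ := isCompact_univ.exists_isMinOn univ_nonempty hφ.continuous.continuousOn
  exact ⟨p, differential_eq_zero_of_forall_le hφ fun x => hp (mem_univ x)⟩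

theorem iInf_norm_grad_sq [CompactSpace M] [Nonempty M] {φ : M → ℝ} (hφ : Smooth n φ) :
    ⨅ x, ‖grad n φ x‖ ^ 2 = 0 := by
  obtain ⟨p, hp⟩ := criticalPoints_nonempty hφ
  refine le_antisymm ?_ (le_ciInf fun x => sq_nonneg _)
  rw [← (norm_grad_sq_eq_zero_iff φ p).2 hp]
  exact ciInf_le ⟨0, by rintro _ ⟨x, rfl⟩; exact sq_nonneg _⟩ p

variable [IsContMDiffRiemannianBundle (𝓡 n) ∞ (EuclideanSpace ℝ (Fin n))
      (fun x : M => TangentSpace (𝓡 n) x)]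
  [MeasurableSpace M] [BorelSpace M] [CompactSpace M] [T2Space M]

theorem exists_potential_bound {φ c : M → ℝ} (hφ : Smooth n φ) (hc : Smooth n c) :
    ∃ C, 0 ≤ C ∧ ∀ ε > 0, ∀ x, ‖grad n φ x‖ ^ 2 / 4 - C * ε ≤ potential n φ c ε x ∧
      potential n φ c ε x ≤ ‖grad n φ x‖ ^ 2 / 4 + C * ε := by
  have hk : Continuous fun x => c x + laplacian n φ x / 2 :=
    hc.continuous.add ((continuous_laplacian hφ).div_const 2)
  obtain ⟨C, hC⟩ := isCompact_univ.exists_bound_of_continuousOn hk.continuousOn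
  refine ⟨max C 0, le_max_right _ _, fun ε hε x => ?_⟩
  have h1 : |c x + laplacian n φ x / 2| ≤ max C 0 := (hC x (mem_univ x)).trans (le_max_left _ _)
  have h2 := abs_le.1 h1
  rw [potential_eq]
  constructor <;> nlinarith

theorem continuous_potential {φ c : M → ℝ} (hφ : Smooth n φ) (hc : Smooth n c) (ε : ℝ) :
    Continuous (potential n φ c ε) := by
  have h := continuous_norm_grad_sq hφ
  have h2 := continuous_laplacian hφ
  have h3 := hc.continuous
  unfold potential
  fun_prop

theorem InH1WithEnergy.energy_nonneg {v : M → ℝ} {E : ℝ} (h : InH1WithEnergy n v E) : 0 ≤ E := by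
  obtain ⟨_, f, -, -, -, hE⟩ := h
  exact ge_of_tendsto' hE fun k => integral_nonneg fun x => sq_nonneg _

theorem InH1WithEnergy.integrable_sq {v : M → ℝ} {E : ℝ} (h : InH1WithEnergy n v E) :
    Integrable (fun x => v x ^ 2) (riemVolume n M) := h.1.integrable_sq

theorem Smooth.inH1WithEnergy {v : M → ℝ} (hv : Smooth n v) :
    InH1WithEnergy n v (∫ x, ‖grad n v x‖ ^ 2 ∂(riemVolume n M)) := by
  refine ⟨hv.continuous.memLp_of_hasCompactSupport (HasCompactSupport.of_compactSpace _),
    fun _ => v, fun _ => hv, ?_, fun η hη => ⟨0, fun k _ l _ => ?_⟩, tendsto_const_nhds⟩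
  · simp
  · have h0 : ∀ x, grad n (v - v) x = 0 := fun x => by
      rw [sub_self, grad_eq_zero_iff]
      exact mfderiv_const
    simp only [h0]
    simpa using hη

/-- Both the Dirichlet term and `|∇φ|²/4` are nonnegative and are dropped. -/
theorem rayleigh_lower_bound {φ c : M → ℝ} (hφ : Smooth n φ) (hc : Smooth n c) {C ε : ℝ}
    (hC : ∀ x, ‖grad n φ x‖ ^ 2 / 4 - C * ε ≤ potential n φ c ε x)
    {v : M → ℝ} {E : ℝ} (hv : InH1WithEnergy n v E)
    (hv0 : ∫ x, v x ^ 2 ∂(riemVolume n M) ≠ 0) :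
    -(C * ε) ≤ rayleigh n ε (potential n φ c ε) v E := by
  have hpos : 0 < ∫ x, v x ^ 2 ∂(riemVolume n M) :=
    (integral_nonneg fun x => sq_nonneg _).lt_of_ne hv0.symm
  rw [rayleigh, le_div_iff₀ hpos, ← integral_const_mul]
  have h1 : ∫ x, -(C * ε) * v x ^ 2 ∂(riemVolume n M) ≤
      ∫ x, potential n φ c ε x * v x ^ 2 ∂(riemVolume n M) :=
    integral_mono (hv.integrable_sq.const_mul _)
      ((continuous_potential hφ hc ε).mul_integrable_of_compactSpace hv.integrable_sq) fun x =>
        mul_le_mul_of_nonneg_right (by linarith [hC x, sq_nonneg ‖grad n φ x‖]) (sq_nonneg _)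
  have h2 : 0 ≤ ε ^ 2 * E := mul_nonneg (sq_nonneg _) hv.energy_nonneg
  linarith

theorem bddBelow_rayleighValues {φ c : M → ℝ} (hφ : Smooth n φ) (hc : Smooth n c) {ε : ℝ}
    (hε : 0 < ε) : BddBelow (rayleighValues n ε (potential n φ c ε)) := by
  obtain ⟨C, -, hC⟩ := exists_potential_bound hφ hc
  refine ⟨-(C * ε), ?_⟩
  rintro _ ⟨v, E, hv, hv0, rfl⟩
  exact rayleigh_lower_bound hφ hc (fun x => (hC ε hε x).1) hv hv0

theorem Smooth.integral_sq_pos {v : M → ℝ} (hv : Smooth n v) {x : M} (hx : v x ≠ 0) :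
    0 < ∫ x, v x ^ 2 ∂(riemVolume n M) :=
  (hv.continuous.pow 2).integral_pos_of_hasCompactSupport_nonneg_nonzero
    (HasCompactSupport.of_compactSpace _) (fun x => sq_nonneg (v x)) (pow_ne_zero 2 hx)

theorem Smooth.rayleigh_mem {a v : M → ℝ} {ε : ℝ} (hv : Smooth n v) {x : M} (hx : v x ≠ 0) :
    rayleigh n ε a v (∫ x, ‖grad n v x‖ ^ 2 ∂(riemVolume n M)) ∈ rayleighValues n ε a :=
  ⟨v, _, hv.inH1WithEnergy, (hv.integral_sq_pos hx).ne', rfl⟩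

theorem mul_firstEigenvalue (φ c : M → ℝ) {ε : ℝ} (hε : 0 < ε) :
    ε * firstEigenvalue n φ c ε = sInf (rayleighValues n ε (potential n φ c ε)) := by
  rw [firstEigenvalue, mul_div_cancel₀ _ hε.ne']

theorem rayleigh_of_driftOp_eq {φ c u : M → ℝ} (hφ : Smooth n φ) (hc : Smooth n c)
    (hu : Smooth n u) {ε lam : ℝ} (hε : 0 < ε) {x₀ : M} (hx₀ : u x₀ ≠ 0)
    (heq : ∀ x, driftOp n ε (grad n φ) c u x = lam * u x) :
    rayleigh n ε (potential n φ c ε) (fun x => u x * gauge φ ε x)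
      (∫ x, ‖grad n (fun x => u x * gauge φ ε x) x‖ ^ 2 ∂(riemVolume n M)) = ε * lam := by
  have hv : Smooth n (fun x => u x * gauge φ ε x) := hu.mul (hφ.gauge ε)
  set v := fun x => u x * gauge φ ε x with hvdef
  have hvx : v x₀ ≠ 0 := mul_ne_zero hx₀ (Real.exp_pos _).ne'
  -- The conjugated equation multiplied by `v`; once integrated, Green's formula turns its first
  -- term into the energy.
  have h1 : ∀ x, ε ^ 2 * (v x * laplacian n v x) + potential n φ c ε x * v x ^ 2 =
      ε * lam * v x ^ 2 := fun x => by
    have h := (driftOp_eq_iff hφ hu hε lam x).1 (heq x)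
    change ε ^ 2 * laplacian n v x + potential n φ c ε x * v x = ε * lam * v x at h
    linear_combination v x * h
  have i1 : Integrable (fun x => v x * laplacian n v x) (riemVolume n M) :=
    integrable_of_continuous (hv.continuous.mul (continuous_laplacian hv))
  have i2 : Integrable (fun x => potential n φ c ε x * v x ^ 2) (riemVolume n M) :=
    integrable_of_continuous ((continuous_potential hφ hc ε).mul (hv.continuous.pow 2))
  have h2 : ε ^ 2 * ∫ x, v x * laplacian n v x ∂(riemVolume n M) +
      ∫ x, potential n φ c ε x * v x ^ 2 ∂(riemVolume n M) =
      ε * lam * ∫ x, v x ^ 2 ∂(riemVolume n M) := by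
    rw [← integral_const_mul, ← integral_const_mul, ← integral_add (i1.const_mul _) i2]
    exact integral_congr_ae (Eventually.of_forall h1)
  rw [rayleigh, integral_norm_grad_sq hv, h2, mul_div_cancel_right₀ _ (hv.integral_sq_pos hvx).ne']

theorem firstEigenvalue_le_of_driftOp_eq {φ c u : M → ℝ} (hφ : Smooth n φ) (hc : Smooth n c)
    (hu : Smooth n u) {ε lam : ℝ} (hε : 0 < ε) {x₀ : M} (hx₀ : u x₀ ≠ 0)
    (heq : ∀ x, driftOp n ε (grad n φ) c u x = lam * u x) : firstEigenvalue n φ c ε ≤ lam := by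
  have hv : Smooth n (fun x => u x * gauge φ ε x) := hu.mul (hφ.gauge ε)
  have h := csInf_le (bddBelow_rayleighValues hφ hc hε)
    (hv.rayleigh_mem (a := potential n φ c ε) (ε := ε)
      (mul_ne_zero hx₀ (Real.exp_pos _).ne' : u x₀ * gauge φ ε x₀ ≠ 0))
  rw [rayleigh_of_driftOp_eq hφ hc hu hε hx₀ heq, ← mul_firstEigenvalue φ c hε] at h
  exact le_of_mul_le_mul_left h hε

theorem isMinimizer_of_driftOp_eq {φ c u : M → ℝ} (hφ : Smooth n φ) (hc : Smooth n c)
    (hu : Smooth n u) {ε : ℝ} (hε : 0 < ε) {x₀ : M} (hx₀ : u x₀ ≠ 0)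
    (heq : ∀ x, driftOp n ε (grad n φ) c u x = firstEigenvalue n φ c ε * u x) :
    IsMinimizer n φ c ε (fun x => u x * gauge φ ε x) := by
  have hv : Smooth n (fun x => u x * gauge φ ε x) := hu.mul (hφ.gauge ε)
  exact ⟨_, hv.inH1WithEnergy, (hv.integral_sq_pos
    (mul_ne_zero hx₀ (Real.exp_pos _).ne' : u x₀ * gauge φ ε x₀ ≠ 0)).ne',
    rayleigh_of_driftOp_eq hφ hc hu hε hx₀ heq⟩

/-- The trial function is a bump `f`, independent of `ε`, supported where `|∇φ|² < η` around a
critical point. Its quotient is at most `ε²E/I + η/4 + Cε`, which tends to `η/4 < η`. -/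
theorem eventually_mul_firstEigenvalue_lt [Nonempty M] {φ c : M → ℝ} (hφ : Smooth n φ)
    (hc : Smooth n c) {η : ℝ} (hη : 0 < η) :
    ∀ᶠ ε in 𝓝[>] 0, ε * firstEigenvalue n φ c ε < η := by
  obtain ⟨C, hC0, hC⟩ := exists_potential_bound hφ hc
  obtain ⟨p, hp⟩ := criticalPoints_nonempty hφ
  have hU : {x | ‖grad n φ x‖ ^ 2 < η} ∈ 𝓝 p :=
    (isOpen_lt (continuous_norm_grad_sq hφ) continuous_const).mem_nhds
      (by rw [mem_ofPred_eq, (norm_grad_sq_eq_zero_iff φ p).2 hp]; exact hη)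
  obtain ⟨f, -, hf⟩ := (SmoothBumpFunction.nhds_basis_tsupport (I := 𝓡 n) p).mem_iff.1 hU
  have hfs : Smooth n f := f.contMDiff
  have hfp : f p ≠ 0 := by rw [f.eq_one]; exact one_ne_zero
  set I := ∫ x, f x ^ 2 ∂(riemVolume n M) with hI
  have hIpos : 0 < I := hfs.integral_sq_pos hfp
  set E := ∫ x, ‖grad n f x‖ ^ 2 ∂(riemVolume n M) with hE
  have hle : ∀ ε > 0, ε * firstEigenvalue n φ c ε ≤ ε ^ 2 * E / I + (η / 4 + C * ε) := by
    intro ε hε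
    rw [mul_firstEigenvalue φ c hε]
    refine (csInf_le (bddBelow_rayleighValues hφ hc hε)
      (hfs.rayleigh_mem (a := potential n φ c ε) (ε := ε) hfp)).trans ?_
    rw [rayleigh, ← hI, ← hE, add_div]
    gcongr
    rw [div_le_iff₀ hIpos, hI, ← integral_const_mul]
    refine integral_mono (integrable_of_continuous ((continuous_potential hφ hc ε).mul
      (hfs.continuous.pow 2))) (integrable_of_continuous (continuous_const.mul
      (hfs.continuous.pow 2))) fun x => ?_
    by_cases hx : x ∈ tsupport f
    · have h1 : ‖grad n φ x‖ ^ 2 < η := hf hx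
      exact mul_le_mul_of_nonneg_right (by linarith [(hC ε hε x).2]) (sq_nonneg _)
    · simp [image_eq_zero_of_notMem_tsupport hx]
  have hcont : Continuous fun ε : ℝ => ε ^ 2 * E / I + (η / 4 + C * ε) := by fun_prop
  have hlim := (hcont.tendsto 0).mono_left (nhdsWithin_le_nhds (s := Ioi (0 : ℝ)))
  have hlt : (0 : ℝ) ^ 2 * E / I + (η / 4 + C * 0) < η := by
    norm_num
    linarith
  filter_upwards [hlim.eventually (gt_mem_nhds hlt), self_mem_nhdsWithin] with ε h1 h2
  exact (hle ε h2).trans_lt h1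

theorem tendsto_mul_firstEigenvalue [Nonempty M] {φ c : M → ℝ} (hφ : Smooth n φ)
    (hc : Smooth n c) : Tendsto (fun ε => ε * firstEigenvalue n φ c ε) (𝓝[>] 0) (𝓝 0) := by
  obtain ⟨C, hC0, hC⟩ := exists_potential_bound hφ hc
  have hcont : Continuous fun ε : ℝ => -(C * ε) := by fun_prop
  have hlim := (hcont.tendsto 0).mono_left (nhdsWithin_le_nhds (s := Ioi (0 : ℝ)))
  rw [mul_zero, neg_zero] at hlim
  refine tendsto_order.2 ⟨fun a ha => ?_, fun a ha => eventually_mul_firstEigenvalue_lt hφ hc ha⟩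
  filter_upwards [hlim.eventually (lt_mem_nhds ha), self_mem_nhdsWithin] with ε h1 hε
  refine h1.trans_le ?_
  rw [mul_firstEigenvalue φ c hε]
  obtain ⟨x₀⟩ := ‹Nonempty M›
  -- The constant function `1` shows that the set of quotients is nonempty.
  refine le_csInf ⟨_, Smooth.rayleigh_mem (v := fun _ : M => (1 : ℝ)) contMDiff_const
    (x := x₀) one_ne_zero⟩ ?_
  rintro _ ⟨v, E, hv, hv0, rfl⟩
  exact rayleigh_lower_bound hφ hc (fun x => (hC ε hε x).1) hv hv0

theorem IsMinimizer.integral_potential_le {φ c v : M → ℝ} {ε : ℝ} (h : IsMinimizer n φ c ε v) :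
    (∫ x, potential n φ c ε x * v x ^ 2 ∂(riemVolume n M)) / ∫ x, v x ^ 2 ∂(riemVolume n M) ≤
      ε * firstEigenvalue n φ c ε := by
  obtain ⟨E, hE, hv0, hr⟩ := h
  have hpos : 0 < ∫ x, v x ^ 2 ∂(riemVolume n M) :=
    (integral_nonneg fun x => sq_nonneg _).lt_of_ne hv0.symm
  rw [← hr, rayleigh]
  gcongr
  have := mul_nonneg (sq_nonneg ε) hE.energy_nonneg
  linarith

theorem IsMinimizer.integrable_sq {φ c v : M → ℝ} {ε : ℝ} (h : IsMinimizer n φ c ε v) :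
    Integrable (fun x => v x ^ 2) (riemVolume n M) := by
  obtain ⟨E, hE, -, -⟩ := h
  exact hE.integrable_sq

theorem IsMinimizer.integral_sq_pos {φ c v : M → ℝ} {ε : ℝ} (h : IsMinimizer n φ c ε v) :
    0 < ∫ x, v x ^ 2 ∂(riemVolume n M) := by
  obtain ⟨E, hE, hv0, hr⟩ := h
  exact (integral_nonneg fun x => sq_nonneg _).lt_of_ne hv0.symm

theorem IsMinimizer.le_integral_potential {φ c v : M → ℝ} {C ε : ℝ} (h : IsMinimizer n φ c ε v)
    (hφ : Smooth n φ) (hc : Smooth n c)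
    (hC : ∀ x, ‖grad n φ x‖ ^ 2 / 4 - C * ε ≤ potential n φ c ε x) :
    (∫ x, ‖grad n φ x‖ ^ 2 * (v x ^ 2 / ∫ y, v y ^ 2 ∂(riemVolume n M)) ∂(riemVolume n M)) / 4
      - C * ε ≤ (∫ x, potential n φ c ε x * v x ^ 2 ∂(riemVolume n M)) /
        ∫ x, v x ^ 2 ∂(riemVolume n M) := by
  have hpos := h.integral_sq_pos
  set I := ∫ x, v x ^ 2 ∂(riemVolume n M)
  have i1 := (continuous_norm_grad_sq hφ).mul_integrable_of_compactSpace h.integrable_sq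
  have h1 : ∫ x, ‖grad n φ x‖ ^ 2 * (v x ^ 2 / I) ∂(riemVolume n M) =
      (∫ x, ‖grad n φ x‖ ^ 2 * v x ^ 2 ∂(riemVolume n M)) / I := by
    rw [← integral_div]
    exact integral_congr_ae (Eventually.of_forall fun x => by ring)
  have h2 : (1 / 4) * (∫ x, ‖grad n φ x‖ ^ 2 * v x ^ 2 ∂(riemVolume n M)) - C * ε * I ≤
      ∫ x, potential n φ c ε x * v x ^ 2 ∂(riemVolume n M) := by
    rw [← integral_const_mul, ← integral_const_mul, ← integral_sub (i1.const_mul _)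
      (h.integrable_sq.const_mul _)]
    refine integral_mono ((i1.const_mul _).sub (h.integrable_sq.const_mul _))
      ((continuous_potential hφ hc ε).mul_integrable_of_compactSpace h.integrable_sq) fun x => ?_
    have := mul_le_mul_of_nonneg_right (hC x) (sq_nonneg (v x))
    simp only []
    linarith
  rw [h1, le_div_iff₀ hpos, sub_mul, div_right_comm, div_mul_cancel₀ _ hpos.ne']
  linarith

theorem tendsto_integral_potential_minimizer [Nonempty M] {φ c : M → ℝ} (hφ : Smooth n φ)
    (hc : Smooth n c) {v : ℝ → M → ℝ} (hv : ∀ ε > 0, IsMinimizer n φ c ε (v ε)) :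
    Tendsto (fun ε => (∫ x, potential n φ c ε x * v ε x ^ 2 ∂(riemVolume n M)) /
      ∫ x, v ε x ^ 2 ∂(riemVolume n M)) (𝓝[>] 0) (𝓝 0) := by
  obtain ⟨C, hC0, hC⟩ := exists_potential_bound hφ hc
  have hcont : Continuous fun ε : ℝ => -(C * ε) := by fun_prop
  have hlim := (hcont.tendsto 0).mono_left (nhdsWithin_le_nhds (s := Ioi (0 : ℝ)))
  rw [mul_zero, neg_zero] at hlim
  refine tendsto_of_tendsto_of_tendsto_of_le_of_le' hlim (tendsto_mul_firstEigenvalue hφ hc) ?_ ?_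
  · filter_upwards [self_mem_nhdsWithin] with ε hε
    have h1 := (hv ε hε).le_integral_potential hφ hc fun x => (hC ε hε x).1
    have h2 : 0 ≤ ∫ x, ‖grad n φ x‖ ^ 2 * (v ε x ^ 2 / ∫ y, v ε y ^ 2 ∂(riemVolume n M))
        ∂(riemVolume n M) := integral_nonneg fun x => mul_nonneg (sq_nonneg _)
      (div_nonneg (sq_nonneg _) (hv ε hε).integral_sq_pos.le)
    linarith
  · filter_upwards [self_mem_nhdsWithin] with ε hε using (hv ε hε).integral_potential_le

/-- The integral is squeezed between `0` and four times the normalized integral of `a_ε v²` plus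
`4Cε`. This is the hypothesis `∫ Sρ → 0` of the concentration lemmas, with `S = |∇φ|²`. -/
theorem tendsto_integral_norm_grad_sq_minimizer [Nonempty M] {φ c : M → ℝ} (hφ : Smooth n φ)
    (hc : Smooth n c) {v : ℝ → M → ℝ} (hv : ∀ ε > 0, IsMinimizer n φ c ε (v ε)) :
    Tendsto (fun ε => ∫ x, ‖grad n φ x‖ ^ 2 * (v ε x ^ 2 / ∫ y, v ε y ^ 2 ∂(riemVolume n M))
      ∂(riemVolume n M)) (𝓝[>] 0) (𝓝 0) := by
  obtain ⟨C, hC0, hC⟩ := exists_potential_bound hφ hc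
  have hcont : Continuous fun ε : ℝ => 4 * (C * ε) := by fun_prop
  have hlim := ((tendsto_integral_potential_minimizer hφ hc hv).const_mul 4).add
    ((hcont.tendsto 0).mono_left (nhdsWithin_le_nhds (s := Ioi (0 : ℝ))))
  simp only [mul_zero, add_zero] at hlim
  refine tendsto_of_tendsto_of_tendsto_of_le_of_le' tendsto_const_nhds hlim ?_ ?_
  · filter_upwards [self_mem_nhdsWithin] with ε hε
    exact integral_nonneg fun x => mul_nonneg (sq_nonneg _)
      (div_nonneg (sq_nonneg _) (hv ε hε).integral_sq_pos.le)
  · filter_upwards [self_mem_nhdsWithin] with ε hε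
    have h1 := (hv ε hε).le_integral_potential hφ hc fun x => (hC ε hε x).1
    linarith

theorem IsMinimizer.integral_normalized {φ c v : M → ℝ} {ε : ℝ} (h : IsMinimizer n φ c ε v) :
    ∫ x, v x ^ 2 / ∫ y, v y ^ 2 ∂(riemVolume n M) ∂(riemVolume n M) = 1 := by
  rw [integral_div, div_self h.integral_sq_pos.ne']

theorem tendsto_integral_mul_minimizer [Nonempty M] {φ c : M → ℝ} (hφ : Smooth n φ)
    (hc : Smooth n c) {v : ℝ → M → ℝ} (hv : ∀ ε > 0, IsMinimizer n φ c ε (v ε))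
    (hv1 : ∀ ε > 0, ∫ x, v ε x ^ 2 ∂(riemVolume n M) = 1) {h : M → ℝ} (hh : Continuous h)
    (hzero : ∀ x ∈ criticalPoints n φ, h x = 0) :
    Tendsto (fun ε => ∫ x, h x * v ε x ^ 2 ∂(riemVolume n M)) (𝓝[>] 0) (𝓝 0) := by
  refine tendsto_integral_mul_zero (continuous_norm_grad_sq hφ) (fun x => sq_nonneg _)
    (Eventually.of_forall fun ε x => sq_nonneg (v ε x))
    (by filter_upwards [self_mem_nhdsWithin] with ε hε using hv1 ε hε) ?_ hh
    fun x hx => hzero x ((norm_grad_sq_eq_zero_iff φ x).1 hx)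
  refine (tendsto_integral_norm_grad_sq_minimizer hφ hc hv).congr' ?_
  filter_upwards [self_mem_nhdsWithin] with ε hε
  simp only [hv1 ε hε, div_one]

end Variational

end RiemGeom

/-! ### Concentration of minimizers and of first eigenfunctions. -/

namespace RiemGeom

section Concentration

variable {n : ℕ} {M : Type*} [EMetricSpace M] [CompactSpace M] [Nonempty M]
  [ChartedSpace (EuclideanSpace ℝ (Fin n)) M] [IsManifold (𝓡 n) ∞ M]
  [RiemannianBundle (fun x : M => TangentSpace (𝓡 n) x)]
  [IsContMDiffRiemannianBundle (𝓡 n) ∞ (EuclideanSpace ℝ (Fin n))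
      (fun x : M => TangentSpace (𝓡 n) x)]
  [MeasurableSpace M] [BorelSpace M]

theorem IsNullSeq.tendsto {e : ℕ → ℝ} (he : IsNullSeq e) : Tendsto e atTop (𝓝[>] 0) :=
  tendsto_nhdsWithin_iff.2 ⟨he.2, Eventually.of_forall he.1⟩

/-- `|∇φ|²` is itself an admissible test function, so its integral against `μ` is zero; the open set
where it is nonzero is then `μ`-null. -/
theorem support_subset_criticalPoints {φ c : M → ℝ} (hφ : Smooth n φ) (hc : Smooth n c)
    {v : ℝ → M → ℝ} (hv : ∀ ε > 0, IsMinimizer n φ c ε (v ε))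
    (hv1 : ∀ ε > 0, ∫ x, v ε x ^ 2 ∂(riemVolume n M) = 1) {μ : Measure M}
    (hμ : IsWeakLimit (fun ε => densityMeasure (riemVolume n M) (fun x => v ε x ^ 2)) μ) :
    μ.support ⊆ criticalPoints n φ := by
  obtain ⟨hfin, e, he, hconv⟩ := hμ
  have hS := continuous_norm_grad_sq hφ
  have h1 := (tendsto_integral_mul_minimizer hφ hc hv hv1 hS
    fun x hx => (norm_grad_sq_eq_zero_iff φ x).2 hx).comp he.tendsto
  have h2 := hconv _ hS
  have h3 : ∀ k, ∫ x, ‖grad n φ x‖ ^ 2 ∂(densityMeasure (riemVolume n M) (fun x => v (e k) x ^ 2)) =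
      ∫ x, ‖grad n φ x‖ ^ 2 * v (e k) x ^ 2 ∂(riemVolume n M) := fun k =>
    integral_densityMeasure (hv _ (he.1 k)).integrable_sq.aemeasurable (fun x => sq_nonneg _) _
  simp only [h3] at h2
  have h4 : ∫ x, ‖grad n φ x‖ ^ 2 ∂μ = 0 := tendsto_nhds_unique h2 h1
  rw [integral_eq_zero_iff_of_nonneg (fun x => sq_nonneg _)
    (hS.integrable_of_hasCompactSupport (HasCompactSupport.of_compactSpace _))] at h4
  intro x hx
  by_contra hxc
  refine (Measure.notMem_support_iff_exists.2 ⟨{x | ‖grad n φ x‖ ^ 2 ≠ 0},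
    (isOpen_ne_fun hS continuous_const).mem_nhds
      fun h => hxc ((norm_grad_sq_eq_zero_iff φ x).1 h), ?_⟩) hx
  exact ae_iff.1 h4

/-- If the essential supremum were at most `K`, an open neighbourhood `U` of the null set of
critical points with small volume would carry mass at most `1/2`, while the mass off `U` is
eventually below `1/2`; the total is `1`. -/
theorem tendsto_essSup_minimizer (hn : n ≠ 0) {φ c : M → ℝ} (hφ : Smooth n φ) (hc : Smooth n c)
    (hcrit : (criticalPoints n φ).Finite)
    {v : ℝ → M → ℝ} (hv : ∀ ε > 0, IsMinimizer n φ c ε (v ε))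
    (hv1 : ∀ ε > 0, ∫ x, v ε x ^ 2 ∂(riemVolume n M) = 1)
    (hv0 : ∀ ε > 0, ∀ᵐ x ∂(riemVolume n M), 0 ≤ v ε x) :
    Tendsto (fun ε => essSup (fun x => (v ε x : EReal)) (riemVolume n M)) (𝓝[>] 0) (𝓝 ⊤) := by
  rw [EReal.tendsto_nhds_top_iff_real]
  intro K
  have hcrit0 : riemVolume n M (criticalPoints n φ) = 0 := by
    rw [← biUnion_of_singleton (criticalPoints n φ), measure_biUnion_null_iff hcrit.countable]
    exact fun x _ => riemVolume_singleton hn x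
  -- Chosen so that `r K² ≤ 1/2`; the summand `1` keeps it meaningful for `K = 0`.
  set r : ℝ := 1 / (2 * (K ^ 2 + 1)) with hr
  have hrpos : 0 < r := by positivity
  obtain ⟨U, hcU, hU, hUr⟩ := Set.exists_isOpen_lt_of_lt (μ := riemVolume n M)
    (criticalPoints n φ) (ENNReal.ofReal r) (by rw [hcrit0]; exact ENNReal.ofReal_pos.2 hrpos)
  have hUr' : (riemVolume n M).real U < r := by
    rw [Measure.real, ← ENNReal.lt_ofReal_iff_toReal_lt (measure_ne_top _ _)]
    exact hUr
  obtain ⟨h, h0, h1, h01⟩ := exists_continuous_zero_one_of_isClosed hcrit.isClosed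
    hU.isClosed_compl (disjoint_compl_right_iff_subset.2 hcU)
  have hlim := tendsto_integral_mul_minimizer hφ hc hv hv1 h.continuous fun x hx => h0 hx
  filter_upwards [hlim.eventually (gt_mem_nhds (show (0 : ℝ) < 1 / 2 by norm_num)),
    self_mem_nhdsWithin] with ε hε1 hε
  by_contra hcon
  have hle : ∀ᵐ x ∂(riemVolume n M), v ε x ^ 2 ≤ K ^ 2 := by
    filter_upwards [hv0 ε hε, ae_le_essSup (μ := riemVolume n M)
      (f := fun x => (v ε x : EReal))] with x hx0 hx1
    have hx2 : v ε x ≤ K := EReal.coe_le_coe_iff.1 (hx1.trans (not_lt.1 hcon))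
    exact pow_le_pow_left₀ hx0 hx2 2
  have hint := (hv ε hε).integrable_sq
  have i1 : Integrable (fun x => h x * v ε x ^ 2) (riemVolume n M) :=
    h.continuous.mul_integrable_of_compactSpace hint
  have i2 : Integrable (U.indicator fun _ => K ^ 2) (riemVolume n M) :=
    (integrable_const _).indicator hU.measurableSet
  have h3 : ∫ x, v ε x ^ 2 ∂(riemVolume n M) ≤
      ∫ x, (h x * v ε x ^ 2 + U.indicator (fun _ => K ^ 2) x) ∂(riemVolume n M) := by
    refine integral_mono_ae hint (i1.add i2) ?_
    filter_upwards [hle] with x hx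
    by_cases hxU : x ∈ U
    · rw [indicator_of_mem hxU]
      have := mul_nonneg (h01 x).1 (sq_nonneg (v ε x))
      linarith
    · have h4 : h x = 1 := h1 hxU
      rw [indicator_of_notMem hxU, h4, one_mul, add_zero]
  rw [hv1 ε hε, integral_add i1 i2, integral_indicator hU.measurableSet, setIntegral_const,
    smul_eq_mul] at h3
  have h5 : (riemVolume n M).real U * K ^ 2 ≤ r * K ^ 2 :=
    mul_le_mul_of_nonneg_right hUr'.le (sq_nonneg K)
  have h6 : r * K ^ 2 ≤ 1 / 2 := by
    rw [hr, div_mul_eq_mul_div, div_le_div_iff₀ (by positivity) (by norm_num)]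
    linarith
  linarith

variable {φ c : M → ℝ} {u : ℝ → M → ℝ}

theorem integral_normalizedMeasure {ε : ℝ} (hφ : Smooth n φ) {w : M → ℝ} (hw : Smooth n w)
    (f : M → ℝ) :
    ∫ x, f x ∂(normalizedMeasure (riemVolume n M) φ ε w) =
      ∫ x, f x * ((w x * gauge φ ε x) ^ 2 /
        ∫ y, (w y * gauge φ ε y) ^ 2 ∂(riemVolume n M)) ∂(riemVolume n M) := by
  have h : ∀ x, Real.exp (-φ x / ε) * w x ^ 2 = (w x * gauge φ ε x) ^ 2 := fun x => by
    rw [mul_pow, gauge_sq, mul_comm]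
  rw [normalizedMeasure]
  simp only [h]
  refine integral_densityMeasure ?_ (fun x => div_nonneg (sq_nonneg _)
    (integral_nonneg fun x => sq_nonneg _)) f
  exact (((hw.mul (hφ.gauge ε)).continuous.pow 2).div_const _).measurable.aemeasurable

theorem exists_subseq_weakConv_normalizedMeasure (hφ : Smooth n φ) (hc : Smooth n c)
    (hcrit : (criticalPoints n φ).Finite)
    (hu : ∀ ε > 0, Smooth n (u ε))
    (hmin : ∀ ε > 0, IsMinimizer n φ c ε (fun x => u ε x * gauge φ ε x))
    {e : ℕ → ℝ} (he : IsNullSeq e) :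
    ∃ (s : ℕ → ℕ) (coef : M → ℝ), StrictMono s ∧ ∑ P ∈ hcrit.toFinset, coef P ^ 2 = 1 ∧
      WeakConv (fun k => normalizedMeasure (riemVolume n M) φ (e (s k)) (u (e (s k))))
        (diracSum hcrit.toFinset coef) := by
  have h := (tendsto_integral_norm_grad_sq_minimizer hφ hc hmin).comp he.tendsto
  obtain ⟨s, coef, hs, hcoef, hlim⟩ := exists_subseq_tendsto_sum (continuous_norm_grad_sq hφ)
    (fun x => sq_nonneg _) (Z := hcrit.toFinset)
    (fun x hx => hcrit.mem_toFinset.2 ((norm_grad_sq_eq_zero_iff φ x).1 hx))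
    (ρ := fun k x => (u (e k) x * gauge φ (e k) x) ^ 2 /
      ∫ y, (u (e k) y * gauge φ (e k) y) ^ 2 ∂(riemVolume n M))
    (fun k x => div_nonneg (sq_nonneg _) (integral_nonneg fun x => sq_nonneg _))
    (fun k => (hmin _ (he.1 k)).integral_normalized) h
  refine ⟨s, coef, hs, hcoef, fun f hf => ?_⟩
  rw [integral_diracSum _ _ hf]
  refine (hlim f hf).congr fun k => ?_
  rw [integral_normalizedMeasure hφ (hu _ (he.1 _))]

/-- A subsequence converges to a Dirac sum, and a finite measure is determined by integrals of
continuous functions, so `μ` is that sum. The hypothesis on the full sequence then gives the ball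
masses along the full sequence, not merely along the subsequence. -/
theorem eq_diracSum_of_weakConv_normalizedMeasure (hφ : Smooth n φ) (hc : Smooth n c)
    (hcrit : (criticalPoints n φ).Finite)
    (hu : ∀ ε > 0, Smooth n (u ε))
    (hmin : ∀ ε > 0, IsMinimizer n φ c ε (fun x => u ε x * gauge φ ε x))
    {e : ℕ → ℝ} (he : IsNullSeq e) {μ : Measure M} [IsFiniteMeasure μ]
    (hμ : WeakConv (fun k => normalizedMeasure (riemVolume n M) φ (e k) (u (e k))) μ) :
    ∃ coef : M → ℝ, ∑ P ∈ hcrit.toFinset, coef P ^ 2 = 1 ∧ μ = diracSum hcrit.toFinset coef ∧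
      ∃ δ₀ > 0, ∀ δ : ℝ, 0 < δ → δ < δ₀ → ∀ P ∈ hcrit.toFinset,
        Tendsto (fun k => (∫ x in Metric.eball P (ENNReal.ofReal δ),
            Real.exp (-φ x / e k) * u (e k) x ^ 2 ∂(riemVolume n M)) /
          ∫ x, Real.exp (-φ x / e k) * u (e k) x ^ 2 ∂(riemVolume n M)) atTop
          (𝓝 (coef P ^ 2)) := by
  obtain ⟨s, coef, hs, hcoef, hlim⟩ :=
    exists_subseq_weakConv_normalizedMeasure hφ hc hcrit hu hmin he
  have hμeq : μ = diracSum hcrit.toFinset coef :=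
    ext_of_forall_integral_eq_of_IsFiniteMeasure fun f =>
      tendsto_nhds_unique ((hμ f f.continuous).comp hs.tendsto_atTop) (hlim f f.continuous)
  refine ⟨coef, hcoef, hμeq, ?_⟩
  obtain ⟨δ₀, hδ₀, hsep⟩ := exists_pos_forall_lt_edist hcrit.toFinset
  refine ⟨δ₀, hδ₀, fun δ hδ hδδ P hP => ?_⟩
  have h := tendsto_setIntegral_of_tendsto_sum (μ := riemVolume n M) (Z := hcrit.toFinset)
    (coef := coef) (ρ := fun k x => (u (e k) x * gauge φ (e k) x) ^ 2 /
      ∫ y, (u (e k) y * gauge φ (e k) y) ^ 2 ∂(riemVolume n M))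
    (fun k x => div_nonneg (sq_nonneg _) (integral_nonneg fun x => sq_nonneg _))
    (fun k => (hmin _ (he.1 k)).integrable_sq.div_const _)
    (fun f hf => by
      have h1 := hμ f hf
      rw [hμeq, integral_diracSum _ _ hf] at h1
      refine h1.congr fun k => ?_
      rw [integral_normalizedMeasure hφ (hu _ (he.1 _))])
    hP (B := Metric.eball P (ENNReal.ofReal δ)) (C := Metric.closedEBall P (ENNReal.ofReal δ))
    Metric.isOpen_eball (Metric.mem_eball_self (ENNReal.ofReal_pos.2 hδ))
    Metric.isClosed_closedEBall Metric.eball_subset_closedEBall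
    (fun Q hQ hQC => by
      by_contra hQP
      exact absurd (Metric.mem_closedEBall.1 hQC) (not_le.2 (hsep δ hδ hδδ P hP Q hQ hQP)))
  refine h.congr fun k => ?_
  rw [integral_div]
  have h2 : ∀ x, (u (e k) x * gauge φ (e k) x) ^ 2 = Real.exp (-φ x / e k) * u (e k) x ^ 2 :=
    fun x => by rw [mul_pow, gauge_sq, mul_comm]
  simp only [h2]

end Concentration

end RiemGeom

/-! ### Assembly of the four statements. -/

theorem mainTheorem2 {n : ℕ} (hn : 2 ≤ n) {M : Type*} [EMetricSpace M] [CompactSpace M] [Nonempty M]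
    [ChartedSpace (EuclideanSpace ℝ (Fin n)) M] [IsManifold (𝓡 n) ∞ M]
    [RiemannianBundle (fun x : M => TangentSpace (𝓡 n) x)]
    [IsContMDiffRiemannianBundle (𝓡 n) ∞ (EuclideanSpace ℝ (Fin n))
      (fun x : M => TangentSpace (𝓡 n) x)]
    [IsRiemannianManifold (𝓡 n) M] [MeasurableSpace M] [BorelSpace M]
    (φ c : M → ℝ) (hφ : RiemGeom.Smooth n φ) (hc : RiemGeom.Smooth n c)
    (hcrit : (RiemGeom.criticalPoints n φ).Finite)
    (hmin : ∀ p : M, (∀ x, c p ≤ c x) → 0 ≤ c p + RiemGeom.laplacian n φ p / 2) :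
    -- the transformation of the eigenvalue equation
    (∀ ε > 0, ∀ (u : M → ℝ) (lam : ℝ), RiemGeom.Smooth n u →
      ((∀ x, RiemGeom.driftOp n ε (RiemGeom.grad n φ) c u x = lam * u x) ↔
        ∀ x, ε ^ 2 * RiemGeom.laplacian n (fun y => u y * RiemGeom.gauge φ ε y) x
            + RiemGeom.potential n φ c ε x * (u x * RiemGeom.gauge φ ε x)
          = ε * lam * (u x * RiemGeom.gauge φ ε x))) ∧
    -- `λ_ε` is a lower bound of all eigenvalues of the original operator
    (∀ ε > 0, ∀ (u : M → ℝ) (lam : ℝ), RiemGeom.Smooth n u → (∃ x, u x ≠ 0) →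
      (∀ x, RiemGeom.driftOp n ε (RiemGeom.grad n φ) c u x = lam * u x) →
      RiemGeom.firstEigenvalue n φ c ε ≤ lam) ∧
    -- the limit of the eigenvalues
    (⨅ x, ‖RiemGeom.grad n φ x‖ ^ 2) = 0 ∧
    Tendsto (fun ε => ε * RiemGeom.firstEigenvalue n φ c ε) (𝓝[>] 0)
      (𝓝 (⨅ x, ‖RiemGeom.grad n φ x‖ ^ 2)) ∧
    -- normalized minimizers
    (∀ v : ℝ → M → ℝ,
      (∀ ε > 0, RiemGeom.IsMinimizer n φ c ε (v ε) ∧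
        ∫ x, v ε x ^ 2 ∂(RiemGeom.riemVolume n M) = 1) →
      (∀ μ : Measure M,
        RiemGeom.IsWeakLimit
          (fun ε => RiemGeom.densityMeasure (RiemGeom.riemVolume n M) (fun x => v ε x ^ 2)) μ →
        μ.support ⊆ {x | Tendsto (fun ε => RiemGeom.potential n φ c ε x) (𝓝[>] 0) (𝓝 0)} ∧
        μ.support ⊆ RiemGeom.criticalPoints n φ) ∧
      ((∀ ε > 0, ∀ᵐ x ∂(RiemGeom.riemVolume n M), 0 ≤ v ε x) →
        Tendsto (fun ε => essSup (fun x => (v ε x : EReal)) (RiemGeom.riemVolume n M))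
          (𝓝[>] 0) (𝓝 ⊤))) ∧
    -- first eigenfunctions of the original operator
    (∀ u : ℝ → M → ℝ,
      (∀ ε > 0, RiemGeom.Smooth n (u ε) ∧ (∃ x, u ε x ≠ 0) ∧
        ∀ x, RiemGeom.driftOp n ε (RiemGeom.grad n φ) c (u ε) x
          = RiemGeom.firstEigenvalue n φ c ε * u ε x) →
      (∀ ε > 0, RiemGeom.IsMinimizer n φ c ε (fun x => u ε x * RiemGeom.gauge φ ε x)) ∧
      Tendsto (fun ε =>
          (∫ x, Real.exp (-φ x / ε) * u ε x ^ 2 * RiemGeom.potential n φ c ε x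
            ∂(RiemGeom.riemVolume n M)) /
          ∫ x, Real.exp (-φ x / ε) * u ε x ^ 2 ∂(RiemGeom.riemVolume n M))
        (𝓝[>] 0) (𝓝 (⨅ x, ‖RiemGeom.grad n φ x‖ ^ 2)) ∧
      (∀ e : ℕ → ℝ, RiemGeom.IsNullSeq e →
        ∃ (s : ℕ → ℕ) (coef : M → ℝ), StrictMono s ∧
          ∑ P ∈ hcrit.toFinset, coef P ^ 2 = 1 ∧
          RiemGeom.WeakConv
            (fun k => RiemGeom.normalizedMeasure (RiemGeom.riemVolume n M) φ (e (s k)) (u (e (s k))))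
            (RiemGeom.diracSum hcrit.toFinset coef)) ∧
      (∀ e : ℕ → ℝ, RiemGeom.IsNullSeq e → ∀ μ : Measure M, IsFiniteMeasure μ →
        RiemGeom.WeakConv
          (fun k => RiemGeom.normalizedMeasure (RiemGeom.riemVolume n M) φ (e k) (u (e k))) μ →
        ∃ coef : M → ℝ, ∑ P ∈ hcrit.toFinset, coef P ^ 2 = 1 ∧
          μ = RiemGeom.diracSum hcrit.toFinset coef ∧
          ∃ δ₀ > 0, ∀ δ : ℝ, 0 < δ → δ < δ₀ → ∀ P ∈ hcrit.toFinset,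
            Tendsto (fun k =>
                (∫ x in Metric.eball P (ENNReal.ofReal δ),
                  Real.exp (-φ x / e k) * u (e k) x ^ 2 ∂(RiemGeom.riemVolume n M)) /
                ∫ x, Real.exp (-φ x / e k) * u (e k) x ^ 2 ∂(RiemGeom.riemVolume n M))
              atTop (𝓝 (coef P ^ 2)))) := by
  have hn0 : n ≠ 0 := by omega
  rw [RiemGeom.iInf_norm_grad_sq hφ]
  refine ⟨fun ε hε u lam hu => forall_congr' fun x => RiemGeom.driftOp_eq_iff hφ hu hε lam x,
    fun ε hε u lam hu hx heq => ?_, rfl, RiemGeom.tendsto_mul_firstEigenvalue hφ hc,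
    fun v hv => ⟨fun μ hμ => ?_, fun hv0 => ?_⟩, fun u hu => ?_⟩
  · obtain ⟨x₀, hx₀⟩ := hx
    exact RiemGeom.firstEigenvalue_le_of_driftOp_eq hφ hc hu hε hx₀ heq
  · have h := RiemGeom.support_subset_criticalPoints hφ hc (fun ε hε => (hv ε hε).1)
      (fun ε hε => (hv ε hε).2) hμ
    exact ⟨fun x hx => RiemGeom.tendsto_potential_of_mem_criticalPoints (h hx), h⟩
  · exact RiemGeom.tendsto_essSup_minimizer hn0 hφ hc hcrit (fun ε hε => (hv ε hε).1)
      (fun ε hε => (hv ε hε).2) hv0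
  · have hus : ∀ ε > 0, RiemGeom.Smooth n (u ε) := fun ε hε => (hu ε hε).1
    have hm : ∀ ε > 0, RiemGeom.IsMinimizer n φ c ε (fun x => u ε x * RiemGeom.gauge φ ε x) := by
      intro ε hε
      obtain ⟨hs, ⟨x₀, hx₀⟩, heq⟩ := hu ε hε
      exact RiemGeom.isMinimizer_of_driftOp_eq hφ hc hs hε hx₀ heq
    refine ⟨hm, ?_, fun e he =>
      RiemGeom.exists_subseq_weakConv_normalizedMeasure hφ hc hcrit hus hm he, fun e he μ _ hμ =>
      RiemGeom.eq_diracSum_of_weakConv_normalizedMeasure hφ hc hcrit hus hm he hμ⟩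
    refine (RiemGeom.tendsto_integral_potential_minimizer hφ hc hm).congr fun ε => ?_
    have h2 : ∀ x, (u ε x * RiemGeom.gauge φ ε x) ^ 2 = Real.exp (-φ x / ε) * u ε x ^ 2 :=
      fun x => by rw [mul_pow, RiemGeom.gauge_sq, mul_comm]
    simp only [h2]
    congr 1
    exact integral_congr_ae (Eventually.of_forall fun x => mul_comm _ _)
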